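/- Let $\bar{\mathbb R}=\mathbb R\cup\{\pm\infty\}$, let $n\ge 1$, and give $\bar{\mathbb R}^n$ the product order and product topology. For $x\in\bar{\mathbb R}^n$ and $\alpha\in\mathbb R$ write $\vec\alpha=(\alpha,\dots,\alpha)$ and let $\Delta_x=\{x+\vec\alpha\mid\alpha\in\mathbb R\}$ be the diagonal through $x$ (with $\pm\infty+\alpha=\pm\infty$). An interval is a nonempty order-convex subset of $\bar{\mathbb R}^n$ in which any two points $p,q$ are joined by a path $p\le p_1\ge p_2\le\dots\ge p_{2m}\le q$. Let $M,N$ be interval modules over a field with intervals $I_M,I_N\subseteq\bar{\mathbb R}^n$ (the field on the interval, $0$ elsewhere, identity maps inside the interval), where each of $I_M,I_N$ is a finite union of $n$-dimensional rectangles $[a_1,b_1]\times\dots\times[a_n,b_n]$, $a_i<b_i$ in $\bar{\mathbb R}$. Let $M|_{\Delta_x}$ be the restriction of $M$ to the poset $\Delta_x$, let $d_I\in[0,\infty]$ be the interleaving distance (with respect to the shifts $y\mapsto y+\vec\delta$), and $$\delta^*=\inf\{\delta\ge 0\mid \forall x\in\bar{\mathbb R}^n,\ M|_{\Delta_x}\text{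 and }N|_{\Delta_x}\text{ are }\delta\text{-interleaved}\}\in[0,\infty].$$ For an interval $I$, let $L(I)$ (resp. $U(I)$) be the set of $x\in\bar I$ such that no $y$ with $y_i<x_i$ for all $i$ (resp. $y_i>x_i$ for all $i$) lies in $I$. A facet of $I$ is an $(n-1)$-dimensional set $f=\hat f\cap L$ with $L\in\{L(I),U(I)\}$ and flat $\hat f=\{x_i=c\}$, $c\in\bar{\mathbb R}$; $F(I)$ is the set of facets. For a polyhedral set $Q\subseteq\bar{\mathbb R}^n$, $V(Q)$ is the set of its vertices: the points $x\in\bar Q$ such that $\bar Q$ is not, near $x$, invariant under small translations along any nonzero vector $v\in\mathbb R^n$ that vanishes in the infinite coordinates of $x$. For a facet $f$ put $/f/=\{x+\vec t\mid x\in f,\ t\in\mathbb R\}$, and let $$\bar V=\bigcup_{f,g\in F(I_M)\cup F(I_N)}V(/f/\cap g).$$ For a point $x$ and a set $A$ let $\mathrm{dl}(x,A)=\inf_{y\in\Delta_x\cap A}|x-y|_\infty$, which is $+\infty$ if $\Delta_x\cap A=\emptyset$ (equal infinite coordinates have difference $0$). Let $D(x)=\{\mathrm{dl}(x,L(I_M)),\mathrm{dl}(x,L(I_N)),\mathrm{dl}(x,U(I_M)),\mathrm{dl}(x,U(I_N))\}$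 and $\hat D(x)=\{\mathrm{dl}(x,\hat f)\mid f\in F(I_M)\cup F(I_N)\}$, and let $S$ (resp. $\hat S$) be the set of $d\in[0,\infty]$ such that $d\in D(x)$ or $2d\in D(x)$ (resp. $d\in\hat D(x)$ or $2d\in\hat D(x)$) for some $x\in V(I_M)\cup V(I_N)$. Then: (i) $\bar V$ is finite and $\delta^*=\max_{x\in\bar V} d_I(M|_{\Delta_x},N|_{\Delta_x})$; (ii) if $n=2$, then $V(I_M)\cup V(I_N)$ is finite and $\delta^*=\max_{x\in V(I_M)\cup V(I_N)} d_I(M|_{\Delta_x},N|_{\Delta_x})$; (iii) $\delta^*$ belongs to the candidate set $S$ and to the extended candidate set $\hat S$. -/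

import Mathlib

open CategoryTheory
open scoped NNReal ENNReal Topology

namespace MultiPers

universe u

/-! ## Extended space, diagonal shifts, persistence modules and interleavings -/

/-- The poset `ℝ̄ⁿ`, with the product order and the product topology; here
`ℝ̄ = ℝ ∪ {-∞, +∞}`. -/
abbrev Rbar (n : ℕ) : Type := Fin n → EReal

/-- `ℝ̄ⁿ` as a poset category. (The default category structure on a product type is the
product of the factors, in which a morphism is a family of inequalities.) -/
noncomputable instance (n : ℕ) : SmallCategory (Rbar n) := Preorder.smallCategory (Rbar n)

/-- A poset on which the reals act by monotone shifts `x ↦ x + δ`, moving points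
upwards when `0 ≤ δ`. -/
class RealShift (P : Type*) [Preorder P] where
  shift : ℝ → P → P
  shift_zero : ∀ x, shift 0 x = x
  shift_shift : ∀ a b x, shift a (shift b x) = shift (a + b) x
  shift_mono : ∀ δ, Monotone (shift δ)
  le_shift : ∀ δ, 0 ≤ δ → ∀ x, x ≤ shift δ x

open RealShift

/-- The diagonal shift `x ↦ x + (δ, …, δ)` of `ℝ̄ⁿ`; infinite coordinates are fixed. -/
noncomputable instance (n : ℕ) : RealShift (Rbar n) where
  shift δ x := fun i => x i + (δ : EReal)
  shift_zero x := by funext i; simp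
  shift_shift a b x := by
    funext i
    rw [add_assoc, EReal.coe_add, add_comm (b : EReal)]
  shift_mono δ x y h := fun i => add_le_add_left (h i) _
  le_shift δ hδ x := fun i => by
    have h : (0 : EReal) ≤ (δ : EReal) := by exact_mod_cast hδ
    simpa using add_le_add_right h (x i)

/-- The diagonal `Δ_x = {x + (α, …, α) | α ∈ ℝ}`. It is a single point when all
coordinates of `x` are infinite. -/
def diag {n : ℕ} (x : Rbar n) : Set (Rbar n) := {y | ∃ α : ℝ, y = shift α x}

noncomputable instance {n : ℕ} (x : Rbar n) : RealShift (diag x) where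
  shift δ y := ⟨shift δ y.1, by
    obtain ⟨α, hα⟩ := y.2
    exact ⟨δ + α, by rw [hα, shift_shift]⟩⟩
  shift_zero y := Subtype.ext (shift_zero y.1)
  shift_shift a b y := Subtype.ext (shift_shift a b y.1)
  shift_mono δ y z h := shift_mono δ (show y.1 ≤ z.1 from h)
  le_shift δ hδ y := le_shift δ hδ y.1

section Modules

variable {P : Type} [Preorder P] [RealShift P] {K : Type u} [Field K]

/-- The shifted module `M_{→δ}`, with `M_{→δ}(x) = M(x + δ)`. -/
def shiftModule (δ : ℝ) (M : P ⥤ ModuleCat.{u} K) : P ⥤ ModuleCat.{u} K :=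
  (shift_mono (P := P) δ).functor ⋙ M

/-- `M` and `N` are `δ`-interleaved: there are natural families
`φ_x : M_x → N_{x+δ}` and `ψ_x : N_x → M_{x+δ}` (square commutativity) whose
composites are the structure maps `x → x + 2δ` (triangular commutativity). -/
def Interleaved (δ : ℝ≥0) (M N : P ⥤ ModuleCat.{u} K) : Prop :=
  ∃ (φ : M ⟶ shiftModule δ N) (ψ : N ⟶ shiftModule δ M), ∀ x : P,
    (M.map (homOfLE ((le_shift (δ : ℝ) δ.2 x).trans (le_shift (δ : ℝ) δ.2 _))) :
        M.obj x ⟶ M.obj (shift (δ : ℝ) (shift (δ : ℝ) x)))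
      = φ.app x ≫ ψ.app (shift (δ : ℝ) x) ∧
    (N.map (homOfLE ((le_shift (δ : ℝ) δ.2 x).trans (le_shift (δ : ℝ) δ.2 _))) :
        N.obj x ⟶ N.obj (shift (δ : ℝ) (shift (δ : ℝ) x)))
      = ψ.app x ≫ φ.app (shift (δ : ℝ) x)

/-- The interleaving distance, with value `∞` when there is no interleaving at all. -/
noncomputable def interleavingDist (M N : P ⥤ ModuleCat.{u} K) : ℝ≥0∞ :=
  ⨅ (δ : ℝ≥0) (_ : Interleaved δ M N), (δ : ℝ≥0∞)

end Modules

/-- The 1-parameter slice `M|_{Δ_x}`: the restriction of `M` to the poset `Δ_x`. -/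
noncomputable def slice {n : ℕ} {K : Type u} [Field K] (M : Rbar n ⥤ ModuleCat.{u} K) (x : Rbar n) :
    diag x ⥤ ModuleCat.{u} K :=
  (show Monotone (fun y : diag x => y.1) from fun _ _ h => h).functor ⋙ M

/-- `δ*`, the infimum of all `δ` such that all pairs of slices `M|_{Δ_x}`, `N|_{Δ_x}`,
with `x ∈ ℝ̄ⁿ`, are `δ`-interleaved. -/
noncomputable def deltaStar {n : ℕ} {K : Type u} [Field K]
    (M N : Rbar n ⥤ ModuleCat.{u} K) : ℝ≥0∞ :=
  ⨅ (δ : ℝ≥0) (_ : ∀ x : Rbar n, Interleaved δ (slice M x) (slice N x)), (δ : ℝ≥0∞)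

/-! ## Intervals and interval modules -/

/-- An interval of `ℝ̄ⁿ`: nonempty, convex for the order, and any two points `p`, `q`
are joined in it by a path `p ≤ p₁ ≥ p₂ ≤ p₃ ≥ … ≥ p₂ₘ ≤ q`. -/
structure PosetInterval (n : ℕ) where
  carrier : Set (Rbar n)
  nonempty : carrier.Nonempty
  convex : ∀ p ∈ carrier, ∀ q ∈ carrier, ∀ r, p ≤ r → r ≤ q → r ∈ carrier
  connected : ∀ p ∈ carrier, ∀ q ∈ carrier, ∃ (m : ℕ) (s : ℕ → Rbar n),
    s 0 = p ∧ s (2 * m + 1) = q ∧ (∀ j ≤ 2 * m + 1, s j ∈ carrier) ∧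
    (∀ j ≤ m, s (2 * j) ≤ s (2 * j + 1)) ∧ ∀ j < m, s (2 * j + 2) ≤ s (2 * j + 1)

open Classical in
/-- The space of the interval module at `x`: all of `K` if `x ∈ I`, and `0` otherwise. -/
noncomputable def fiber {n : ℕ} (K : Type u) [Field K] (I : Set (Rbar n)) (x : Rbar n) :
    Submodule K K := if x ∈ I then ⊤ else ⊥

open Classical in
/-- The map of the interval module from `x` to `y`: the identity of `K` if `x, y ∈ I`, and
`0` otherwise. -/
noncomputable def fiberMap {n : ℕ} (K : Type u) [Field K] (I : Set (Rbar n))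
    (x y : Rbar n) : fiber K I x →ₗ[K] fiber K I y :=
  if h : x ∈ I ∧ y ∈ I then
    Submodule.inclusion (by rw [fiber, fiber, if_pos h.1, if_pos h.2])
  else 0

theorem fiber_eq_zero {n : ℕ} {K : Type u} [Field K] {I : Set (Rbar n)} {x : Rbar n}
    (h : x ∉ I) (c : fiber K I x) : c = 0 := by
  have h' := c.2
  simp only [fiber, h, if_false, Submodule.mem_bot] at h'
  exact Subtype.ext h'

/-- The interval module of an interval. -/
noncomputable def intervalModule {n : ℕ} (K : Type u) [Field K] (I : PosetInterval n) :
    Rbar n ⥤ ModuleCat.{u} K where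
  obj x := ModuleCat.of K (fiber K I.carrier x)
  map {x y} _ := ModuleCat.ofHom (fiberMap K I.carrier x y)
  map_id x := by
    ext c
    by_cases h : x ∈ I.carrier
    · simp [fiberMap, h]
    · simp [fiber_eq_zero h c]
  map_comp {x y z} f g := by
    ext c
    by_cases hx : x ∈ I.carrier
    · by_cases hz : z ∈ I.carrier
      · have hy := I.convex x hx z hz y (leOfHom f) (leOfHom g)
        simp [fiberMap, hx, hy, hz]
      · simp [fiberMap, hz]
    · simp [fiber_eq_zero hx c]

/-! ## Rectangles, boundaries, facets, vertices -/

/-- A `k`-dimensional rectangle `[a₁,b₁] × … × [aₙ,bₙ]`, with extended real endpoints: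
`aᵢ ≠ bᵢ` for exactly `k` indices. -/
def IsRectangle {n : ℕ} (k : ℕ) (R : Set (Rbar n)) : Prop :=
  ∃ a b : Rbar n, a ≤ b ∧ {i | a i ≠ b i}.ncard = k ∧ R = Set.Icc a b

/-- A finite union of `n`-dimensional rectangles; such a set is closed in `ℝ̄ⁿ`. -/
def DiscretelyPresented {n : ℕ} (I : Set (Rbar n)) : Prop :=
  ∃ T : Set (Set (Rbar n)), T.Finite ∧ (∀ R ∈ T, IsRectangle n R) ∧ I = ⋃₀ T

/-- The lower boundary `L(I)`. -/
def lowerBd {n : ℕ} (I : Set (Rbar n)) : Set (Rbar n) :=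
  {x | x ∈ closure I ∧ ∀ y : Rbar n, (∀ i, y i < x i) → y ∉ I}

/-- The upper boundary `U(I)`. -/
def upperBd {n : ℕ} (I : Set (Rbar n)) : Set (Rbar n) :=
  {x | x ∈ closure I ∧ ∀ y : Rbar n, (∀ i, x i < y i) → y ∉ I}

/-- The hyperplane `{x | xᵢ = c}`, with `c` an extended real. -/
def flat {n : ℕ} (i : Fin n) (c : EReal) : Set (Rbar n) := {x | x i = c}

/-- `f` is a facet of `I` with flat `{xᵢ = c}`: it is the intersection of the flat with
`L(I)` or with `U(I)`, and it has dimension `n - 1`, i.e. contains an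
`(n-1)`-dimensional rectangle. -/
def IsFacet {n : ℕ} (I : Set (Rbar n)) (i : Fin n) (c : EReal) (f : Set (Rbar n)) : Prop :=
  (f = flat i c ∩ lowerBd I ∨ f = flat i c ∩ upperBd I) ∧
    ∃ R : Set (Rbar n), IsRectangle (n - 1) R ∧ R ⊆ f

/-- The facet set `F(I)`. -/
def facets {n : ℕ} (I : Set (Rbar n)) : Set (Set (Rbar n)) :=
  {f | ∃ i c, IsFacet I i c f}

/-- Translation of points of `ℝ̄ⁿ` by a vector of `ℝⁿ`. -/
noncomputable def translateBy {n : ℕ} (v : Fin n → ℝ) (x : Rbar n) : Rbar n := fun i => x i + (v i : EReal)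

/-- Near `x`, the set `Q` is invariant under small translations along `v`. -/
def LocallyInvariant {n : ℕ} (Q : Set (Rbar n)) (x : Rbar n) (v : Fin n → ℝ) : Prop :=
  ∀ᶠ p : Rbar n × ℝ in 𝓝 (x, 0), (p.1 ∈ Q ↔ translateBy (p.2 • v) p.1 ∈ Q)

/-- The vertices of a polyhedral, not necessarily convex, subset of `ℝ̄ⁿ`: the
zero-dimensional faces of its closure, i.e. the points of the closure at which it is not
locally a product with a line. Only lines within the stratum at infinity that contains
`x` count, that is directions `v` that vanish at the infinite coordinates of `x`: thus
the vertices of `ℝ̄ⁿ` are its `2ⁿ` corners, those of a rectangle are its corners, and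
those of a convex polytope in `ℝⁿ` are its extreme points. -/
def vertices {n : ℕ} (Q : Set (Rbar n)) : Set (Rbar n) :=
  {x | x ∈ closure Q ∧ ∀ v : Fin n → ℝ, (∀ i, x i = ⊤ ∨ x i = ⊥ → v i = 0) → v ≠ 0 →
    ¬ LocallyInvariant (closure Q) x v}

/-- `/f/ = {x + (t, …, t) | x ∈ f, t ∈ ℝ}`. -/
def sweep {n : ℕ} (f : Set (Rbar n)) : Set (Rbar n) := {y | ∃ x ∈ f, ∃ t : ℝ, y = shift t x}

/-- `V̄`, the set of all vertices of the sets `/f/ ∩ g`, where `f` and `g` are facets of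
`I` or of `J`. -/
def Vbar {n : ℕ} (I J : Set (Rbar n)) : Set (Rbar n) :=
  {x | ∃ f ∈ facets I ∪ facets J, ∃ g ∈ facets I ∪ facets J, x ∈ vertices (sweep f ∩ g)}

/-! ## Diagonal distance and candidate sets -/

open Classical in
/-- `|x - y|_∞` on `ℝ̄ⁿ`, where equal infinite coordinates have difference `0`. -/
noncomputable def dInfty {n : ℕ} (x y : Rbar n) : ℝ≥0∞ :=
  ⨆ i, if x i = y i then 0 else (x i - y i).abs

/-- `dl(x, A)`, the distance of `x` to `A` along the diagonal `Δ_x`; it is `∞` if `Δ_x`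
does not meet `A`. -/
noncomputable def dl {n : ℕ} (x : Rbar n) (A : Set (Rbar n)) : ℝ≥0∞ :=
  ⨅ y ∈ diag x ∩ A, dInfty x y

/-- `D(x)`. -/
def D {n : ℕ} (I J : Set (Rbar n)) (x : Rbar n) : Set ℝ≥0∞ :=
  {d | d = dl x (lowerBd I) ∨ d = dl x (lowerBd J) ∨ d = dl x (upperBd I) ∨
    d = dl x (upperBd J)}

/-- The candidate set `S`. -/
def candidateS {n : ℕ} (I J : Set (Rbar n)) : Set ℝ≥0∞ :=
  {d | ∃ x ∈ vertices I ∪ vertices J, d ∈ D I J x ∨ 2 * d ∈ D I J x}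

/-- `D̂(x)`, the diagonal distances of `x` to the flats of the facets of `I` and `J`. -/
def Dhat {n : ℕ} (I J : Set (Rbar n)) (x : Rbar n) : Set ℝ≥0∞ :=
  {d | ∃ i c f, (IsFacet I i c f ∨ IsFacet J i c f) ∧ d = dl x (flat i c)}

/-- The extended candidate set `Ŝ`. -/
def candidateShat {n : ℕ} (I J : Set (Rbar n)) : Set ℝ≥0∞ :=
  {d | ∃ x ∈ vertices I ∪ vertices J, d ∈ Dhat I J x ∨ 2 * d ∈ Dhat I J x}

end MultiPers

open MultiPers

namespace MultiPers

open RealShift Set Filter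

universe u

/-! ## Diagonal shifts and rectangle decompositions -/

section Shift

variable {n : ℕ}

/-! Everything is controlled by the corners of the two intervals, that is, their minimal and maximal
points. Each is an endpoint of one of the rectangles, so there are finitely many.

Suppose a diagonal contains `p` and `p + 2δ` in `J`. Choose a minimal `r ≤ p` and a maximal `s ≥ p +
2δ`. If `I` contains `r + t` and `s - v` with `t, v ≤ δ`, then `p + t` lies between them, because `t
+ v ≤ 2δ`, and convexity puts it in `I`. Thus a condition at corners alone (`CornersReach`) moves to
every diagonal (`CornersReach.diagClose`). It makes the identity maps an interleaving on each
diagonal where `I` or `J` has two points `2δ` apart; on the other diagonals the zero maps work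
(`CornersReach.interleaved`). Conversely, an interleaving of the slice through a corner forces the
condition at that corner, since a nonzero structure map over `2e` must factor through a nonzero
space halfway (`Interleaved.shift_mem`). So `δ*` is the largest slice distance over the corners
(`exists_corner_deltaStar_le`).

Near a minimal point `r`, the interval lies in `{y | r ≤ y}`, so no line can be split off there.
Hence corners are vertices of the interval, and also of `/f/ ∩ f` for a facet `f` through the
corner. As no slice distance exceeds `δ*`, the maximum over any set that contains the corners is
`δ*`. The vertex sets are finite because their points have coordinates in a finite set built from
the rectangle endpoints and their differences (`mem_gridLevel_of_tangent`).

For the candidate sets, let the corner condition hold just above a finite `δ`. It can fail just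
below `δ` only if the diagonal of some corner leaves its own interval at distance `2δ`, or first
meets the other one at distance `δ` (`eventually_reach_or`). Either event is a diagonal distance to
a boundary and to the flat of a facet. If there is no such event, `δ*` could be decreased. The value
`∞` is treated separately: if it is not a candidate, the corner condition holds for all large `δ`.
-/

theorem shift_apply (t : ℝ) (x : Rbar n) (i : Fin n) : shift t x i = x i + (t : EReal) := rfl

theorem shift_le_shift {s t : ℝ} (h : s ≤ t) (x : Rbar n) : shift s x ≤ shift t x := by
  have h' := le_shift (t - s) (sub_nonneg.2 h) (shift s x)
  rwa [shift_shift, sub_add_cancel] at h'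

theorem shift_le_comm {t : ℝ} {x y : Rbar n} : shift t x ≤ y ↔ x ≤ shift (-t) y := by
  constructor <;> intro h
  · have := shift_mono (-t) h
    rwa [shift_shift, neg_add_cancel, shift_zero] at this
  · have := shift_mono t h
    rwa [shift_shift, add_neg_cancel, shift_zero] at this

theorem self_mem_diag (x : Rbar n) : x ∈ diag x := ⟨0, (shift_zero x).symm⟩

theorem shift_mem_diag {x p : Rbar n} (h : p ∈ diag x) (t : ℝ) : shift t p ∈ diag x := by
  obtain ⟨α, rfl⟩ := h
  exact ⟨t + α, shift_shift _ _ _⟩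

theorem le_total_of_mem_diag {x p q : Rbar n} (hp : p ∈ diag x) (hq : q ∈ diag x) :
    p ≤ q ∨ q ≤ p := by
  obtain ⟨α, rfl⟩ := hp
  obtain ⟨β, rfl⟩ := hq
  exact (le_total α β).imp (fun h => shift_le_shift h x) fun h => shift_le_shift h x

theorem continuous_add_coe (c : ℝ) : Continuous fun x : EReal => x + (c : EReal) :=
  continuous_iff_continuousAt.2 fun x =>
    (EReal.continuousAt_add (p := (x, (c : EReal))) (Or.inr (EReal.coe_ne_bot c))
      (Or.inr (EReal.coe_ne_top c))).comp₂ continuousAt_id continuousAt_const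

theorem continuous_coe_add (a : EReal) : Continuous fun t : ℝ => a + (t : EReal) :=
  continuous_iff_continuousAt.2 fun t =>
    (EReal.continuousAt_add (p := (a, (t : EReal))) (Or.inr (EReal.coe_ne_bot t))
      (Or.inr (EReal.coe_ne_top t))).comp₂ continuousAt_const
        continuous_coe_real_ereal.continuousAt

theorem continuous_shift_left (x : Rbar n) : Continuous fun t : ℝ => shift t x :=
  continuous_pi fun i => continuous_coe_add (x i)

theorem add_coe_le_add_coe_iff {a b : EReal} (c : ℝ) :
    a + (c : EReal) ≤ b + (c : EReal) ↔ a ≤ b := by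
  constructor <;> intro h
  · have := add_le_add_left h ((-c : ℝ) : EReal)
    rwa [add_assoc, add_assoc, ← EReal.coe_add, add_neg_cancel, EReal.coe_zero, add_zero,
      add_zero] at this
  · exact add_le_add_left h _

theorem add_coe_lt_add_coe_iff {a b : EReal} (c : ℝ) :
    a + (c : EReal) < b + (c : EReal) ↔ a < b :=
  lt_iff_lt_of_le_iff_le (add_coe_le_add_coe_iff c)

theorem eq_top_or_bot_or_coe (a : EReal) : a = ⊤ ∨ a = ⊥ ∨ ∃ c : ℝ, a = c := by
  induction a <;> simp

end Shift

section Rectangles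

variable {n : ℕ}

/-- `I` is the union of the `n`-dimensional rectangles `[p.1, p.2]`, for `p` in the finite
set `T`. -/
structure RectDecomp (I : Set (Rbar n)) (T : Set (Rbar n × Rbar n)) : Prop where
  finite : T.Finite
  lt : ∀ p ∈ T, ∀ i, p.1 i < p.2 i
  mem_iff : ∀ x, x ∈ I ↔ ∃ p ∈ T, p.1 ≤ x ∧ x ≤ p.2

theorem DiscretelyPresented.exists_rectDecomp {I : Set (Rbar n)} (h : DiscretelyPresented I) :
    ∃ T, RectDecomp I T := by
  obtain ⟨T, hT, hR, rfl⟩ := h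
  choose! a b hab hc he using hR
  refine ⟨(fun R => (a R, b R)) '' T, hT.image _, ?_, ?_⟩
  · rintro _ ⟨R, hRT, rfl⟩ i
    refine lt_of_le_of_ne (hab R hRT i) ?_
    have h1 : {i | a R i ≠ b R i} = univ :=
      Set.eq_of_subset_of_ncard_le (subset_univ _)
        (by rw [hc R hRT, Set.ncard_univ, Nat.card_eq_fintype_card, Fintype.card_fin])
    have : i ∈ {i | a R i ≠ b R i} := h1 ▸ mem_univ i
    exact this
  · intro x
    simp only [mem_sUnion, exists_mem_image]
    refine exists_congr fun R => and_congr_right fun hRT => ?_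
    conv_lhs => rw [he R hRT]
    rfl

variable {I : Set (Rbar n)} {T : Set (Rbar n × Rbar n)}

theorem RectDecomp.isClosed (h : RectDecomp I T) : IsClosed I := by
  have : I = ⋃ p ∈ T, Icc p.1 p.2 := by
    ext x
    rw [h.mem_iff]
    simp only [mem_iUnion, mem_Icc, exists_prop]
  rw [this]
  exact h.finite.isClosed_biUnion fun _ _ => isClosed_Icc

theorem RectDecomp.fst_mem (h : RectDecomp I T) {p} (hp : p ∈ T) : p.1 ∈ I :=
  (h.mem_iff _).2 ⟨p, hp, le_rfl, fun i => (h.lt p hp i).le⟩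

theorem RectDecomp.snd_mem (h : RectDecomp I T) {p} (hp : p ∈ T) : p.2 ∈ I :=
  (h.mem_iff _).2 ⟨p, hp, fun i => (h.lt p hp i).le, le_rfl⟩

theorem RectDecomp.exists_eq_fst (h : RectDecomp I T) {r : Rbar n} (hr : Minimal (· ∈ I) r) :
    ∃ p ∈ T, r = p.1 := by
  obtain ⟨p, hp, h1, -⟩ := (h.mem_iff r).1 hr.prop
  exact ⟨p, hp, (hr.eq_of_le (h.fst_mem hp) h1).symm⟩

theorem RectDecomp.exists_eq_snd (h : RectDecomp I T) {r : Rbar n} (hr : Maximal (· ∈ I) r) :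
    ∃ p ∈ T, r = p.2 := by
  obtain ⟨p, hp, -, h1⟩ := (h.mem_iff r).1 hr.prop
  exact ⟨p, hp, (hr.eq_of_ge (h.snd_mem hp) h1).symm⟩

/-- Every point of `I` is above the lower endpoint of a rectangle, so a minimal element of the
finite set of lower endpoints is minimal in all of `I`. -/
theorem RectDecomp.exists_minimal_le (h : RectDecomp I T) {x : Rbar n} (hx : x ∈ I) :
    ∃ r, Minimal (· ∈ I) r ∧ r ≤ x := by
  obtain ⟨p, hp, h1, -⟩ := (h.mem_iff x).1 hx
  obtain ⟨r, hrp, hr⟩ := (h.finite.image Prod.fst).exists_le_minimal (mem_image_of_mem _ hp)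
  obtain ⟨q, hq, rfl⟩ := hr.prop
  refine ⟨q.1, ⟨h.fst_mem hq, fun y hy hyq => ?_⟩, hrp.trans h1⟩
  obtain ⟨p', hp', h2, -⟩ := (h.mem_iff y).1 hy
  exact (hr.le_of_le (mem_image_of_mem _ hp') (h2.trans hyq)).trans h2

theorem RectDecomp.exists_maximal_ge (h : RectDecomp I T) {x : Rbar n} (hx : x ∈ I) :
    ∃ r, Maximal (· ∈ I) r ∧ x ≤ r := by
  obtain ⟨p, hp, -, h1⟩ := (h.mem_iff x).1 hx
  obtain ⟨r, hrp, hr⟩ := (h.finite.image Prod.snd).exists_le_maximal (mem_image_of_mem _ hp)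
  obtain ⟨q, hq, rfl⟩ := hr.prop
  refine ⟨q.2, ⟨h.snd_mem hq, fun y hy hyq => ?_⟩, h1.trans hrp⟩
  obtain ⟨p', hp', -, h2⟩ := (h.mem_iff y).1 hy
  exact h2.trans (hr.le_of_ge (mem_image_of_mem _ hp') (hyq.trans h2))

/-- The minimal and the maximal points of a set. -/
def corners (I : Set (Rbar n)) : Set (Rbar n) := {r | Minimal (· ∈ I) r ∨ Maximal (· ∈ I) r}

theorem RectDecomp.finite_corners (h : RectDecomp I T) : (corners I).Finite := by
  refine ((h.finite.image Prod.fst).union (h.finite.image Prod.snd)).subset ?_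
  rintro r (hr | hr)
  · obtain ⟨p, hp, rfl⟩ := h.exists_eq_fst hr
    exact Or.inl (mem_image_of_mem _ hp)
  · obtain ⟨p, hp, rfl⟩ := h.exists_eq_snd hr
    exact Or.inr (mem_image_of_mem _ hp)

end Rectangles

/-! ## Interleavings of slices of interval modules -/

section Interleaving

variable {n : ℕ} {K : Type u} [Field K]

open Classical in
/-- The map between spaces of two interval modules that is the identity of `K` where both
are nonzero. -/
noncomputable def fiberHom (K : Type u) [Field K] (I J : Set (Rbar n)) (x y : Rbar n) :
    fiber K I x →ₗ[K] fiber K J y :=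
  if h : x ∈ I ∧ y ∈ J then
    Submodule.inclusion (by rw [fiber, fiber, if_pos h.1, if_pos h.2])
  else 0

-- Read in `K`, the map depends only on whether the target point lies in `J`: off `I` the element
-- `c` is already zero. Identities between such maps thereby become equivalences between membership
-- conditions.
open Classical in
theorem coe_fiberHom (I J : Set (Rbar n)) (x y : Rbar n) (c : fiber K I x) :
    (fiberHom K I J x y c : K) = if y ∈ J then (c : K) else 0 := by
  by_cases hx : x ∈ I
  · by_cases hy : y ∈ J <;> simp [fiberHom, hx, hy]
  · simp [fiber_eq_zero hx c]

open Classical in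
theorem coe_fiberMap (I : Set (Rbar n)) (x y : Rbar n) (c : fiber K I x) :
    (fiberMap K I x y c : K) = if y ∈ I then (c : K) else 0 :=
  coe_fiberHom I I x y c

theorem Interleaved.symm {P : Type} [Preorder P] [RealShift P] {δ : ℝ≥0}
    {M N : P ⥤ ModuleCat.{u} K} (h : Interleaved δ M N) : Interleaved δ N M := by
  obtain ⟨φ, ψ, h⟩ := h
  exact ⟨ψ, φ, fun x => ⟨(h x).2, (h x).1⟩⟩

theorem interleavingDist_comm {P : Type} [Preorder P] [RealShift P]
    (M N : P ⥤ ModuleCat.{u} K) : interleavingDist M N = interleavingDist N M := by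
  unfold interleavingDist
  exact iInf_congr fun δ => iInf_congr_Prop ⟨fun h => h.symm, fun h => h.symm⟩ fun _ => rfl

/-- The structure map of `I` from `p` to `p + 2δ` is nonzero and factors through the space of `J` at
`p + δ`, which therefore cannot vanish. -/
theorem Interleaved.shift_mem {I J : PosetInterval n} {δ : ℝ≥0} {x p : Rbar n}
    (h : Interleaved δ (slice (intervalModule K I) x) (slice (intervalModule K J) x))
    (hx : p ∈ diag x) (hp : p ∈ I.carrier) (hp' : shift (2 * (δ : ℝ)) p ∈ I.carrier) :
    shift (δ : ℝ) p ∈ J.carrier := by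
  by_contra hq
  obtain ⟨φ, ψ, h⟩ := h
  have h1 := (h ⟨p, hx⟩).1
  have hp2 : shift (δ : ℝ) (shift (δ : ℝ) p) ∈ I.carrier := by
    rwa [shift_shift, ← two_mul]
  let c : fiber K I.carrier p := ⟨1, by simp [fiber, hp]⟩
  have h2 : φ.app ⟨p, hx⟩ c = (0 : fiber K J.carrier (shift (δ : ℝ) p)) := fiber_eq_zero hq _
  have h3 : (fiberMap K I.carrier p (shift (δ : ℝ) (shift (δ : ℝ) p))) c
      = ψ.app (shift (δ : ℝ) (⟨p, hx⟩ : diag x)) (φ.app ⟨p, hx⟩ c) := by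
    have := congrArg (fun f => f.hom c) h1
    exact this
  have h4 : (fiberMap K I.carrier p (shift (δ : ℝ) (shift (δ : ℝ) p))) c = 0 := by
    rw [h3]
    exact (congrArg _ h2).trans (map_zero (ψ.app (shift (δ : ℝ) (⟨p, hx⟩ : diag x))).hom)
  have h5 := congrArg Subtype.val h4
  rw [coe_fiberMap, if_pos hp2] at h5
  exact one_ne_zero h5

/-- Along `Δ_x`, the set `I` is within `δ` of `J`, both upwards and downwards. -/
def DiagClose (I J : Set (Rbar n)) (δ : ℝ) (x : Rbar n) : Prop :=
  ∀ p ∈ diag x, p ∈ I → (∃ q ∈ diag x, q ∈ J ∧ q ≤ shift δ p) ∧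
    ∃ q ∈ diag x, q ∈ J ∧ p ≤ shift δ q

/-- The morphism of slices given by `fiberHom`. -/
noncomputable def sliceHom {I J : PosetInterval n} {δ : ℝ≥0} {x : Rbar n}
    (hI : DiagClose I.carrier J.carrier δ x) (hJ : DiagClose J.carrier I.carrier δ x) :
    slice (intervalModule K I) x ⟶
      shiftModule (δ : ℝ) (slice (intervalModule K J) x) where
  app p := ModuleCat.ofHom (fiberHom K I.carrier J.carrier p.1 (shift (δ : ℝ) p.1))
  naturality p q f := by
    have key : ∀ c : fiber K I.carrier p.1,
        (fiberHom K I.carrier J.carrier q.1 (shift (δ : ℝ) q.1)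
          (fiberMap K I.carrier p.1 q.1 c) : K) =
        fiberMap K J.carrier (shift (δ : ℝ) p.1) (shift (δ : ℝ) q.1)
          (fiberHom K I.carrier J.carrier p.1 (shift (δ : ℝ) p.1) c) := by
      intro c
      rw [coe_fiberHom, coe_fiberMap, coe_fiberMap, coe_fiberHom]
      have hpq : p.1 ≤ q.1 := leOfHom f
      by_cases hp : p.1 ∈ I.carrier
      · by_cases hq : shift (δ : ℝ) q.1 ∈ J.carrier
        · simp only [hq, if_true]
          congr 1
          -- With `p ∈ I` and `q + δ ∈ J`, the square commutes if and only if `q ∈ I ↔ p + δ ∈ J`.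
          -- Closeness supplies the missing outer point on each side, and convexity fills in the
          -- middle.
          refine propext ⟨fun h => ?_, fun h => ?_⟩
          · obtain ⟨y, -, hy, hyp⟩ := (hI p.1 p.2 hp).1
            exact J.convex _ hy _ hq _ hyp (shift_mono (P := Rbar n) _ hpq)
          · obtain ⟨y, -, hy, hyp⟩ := (hJ _ (shift_mem_diag q.2 _) hq).2
            refine I.convex _ hp _ hy _ hpq ?_
            rw [shift_le_comm, shift_shift, neg_add_cancel, shift_zero] at hyp
            exact hyp
        · simp [hq]
      · simp [fiber_eq_zero hp c]
    ext c
    exact Subtype.ext (key c)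

/-- The interleaving consists of identity maps wherever both spaces are nonzero. The triangles
commute because `p + δ` is squeezed between two points of the other interval. -/
theorem interleaved_of_diagClose {I J : PosetInterval n} {δ : ℝ≥0} {x : Rbar n}
    (hI : DiagClose I.carrier J.carrier δ x) (hJ : DiagClose J.carrier I.carrier δ x) :
    Interleaved δ (slice (intervalModule K I) x) (slice (intervalModule K J) x) := by
  have key : ∀ {I J : PosetInterval n}, DiagClose I.carrier J.carrier δ x →
      ∀ p ∈ diag x, ∀ c : fiber K I.carrier p,
      fiberMap K I.carrier p (shift (δ : ℝ) (shift (δ : ℝ) p)) c =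
      fiberHom K J.carrier I.carrier (shift (δ : ℝ) p) (shift (δ : ℝ) (shift (δ : ℝ) p))
        (fiberHom K I.carrier J.carrier p (shift (δ : ℝ) p) c) := by
    intro I J hI p hpx c
    refine Subtype.ext ?_
    rw [coe_fiberMap, coe_fiberHom, coe_fiberHom]
    by_cases hp : p ∈ I.carrier
    · by_cases hq : shift (δ : ℝ) (shift (δ : ℝ) p) ∈ I.carrier
      · obtain ⟨y, -, hy, hyp⟩ := (hI p hpx hp).1
        obtain ⟨z, -, hz, hzp⟩ := (hI _ (shift_mem_diag (shift_mem_diag hpx _) _) hq).2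
        rw [shift_le_comm, shift_shift, neg_add_cancel, shift_zero] at hzp
        rw [if_pos hq, if_pos (J.convex _ hy _ hz _ hyp hzp), if_pos hq]
      · simp [hq]
    · simp [fiber_eq_zero hp c]
  refine ⟨sliceHom hI hJ, sliceHom hJ hI, fun p => ⟨?_, ?_⟩⟩
  · ext c
    exact key hI p.1 p.2 c
  · ext c
    exact key hJ p.1 p.2 c

theorem interleaved_of_forall_notMem {I J : PosetInterval n} {δ : ℝ≥0} {x : Rbar n}
    (hI : ∀ p ∈ diag x, p ∈ I.carrier → shift (2 * (δ : ℝ)) p ∉ I.carrier)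
    (hJ : ∀ p ∈ diag x, p ∈ J.carrier → shift (2 * (δ : ℝ)) p ∉ J.carrier) :
    Interleaved δ (slice (intervalModule K I) x) (slice (intervalModule K J) x) := by
  have key : ∀ {I : PosetInterval n},
      (∀ p ∈ diag x, p ∈ I.carrier → shift (2 * (δ : ℝ)) p ∉ I.carrier) →
      ∀ p ∈ diag x, ∀ c : fiber K I.carrier p,
      fiberMap K I.carrier p (shift (δ : ℝ) (shift (δ : ℝ) p)) c = 0 := by
    intro I hI p hpx c
    refine Subtype.ext ?_
    rw [coe_fiberMap]
    by_cases hp : p ∈ I.carrier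
    · have := hI p hpx hp
      rw [two_mul, ← shift_shift] at this
      rw [if_neg this]
      rfl
    · simp [fiber_eq_zero hp c]
  refine ⟨0, 0, fun p => ⟨?_, ?_⟩⟩
  · ext c
    exact key hI p.1 p.2 c
  · ext c
    exact key hJ p.1 p.2 c

/-- From the minimal and the maximal points of `J` at which `J` has diagonal length at
least `2δ`, the set `I` is reached within `δ`. -/
def CornersReach (I J : Set (Rbar n)) (δ : ℝ) : Prop :=
  (∀ r, Minimal (· ∈ J) r → shift (2 * δ) r ∈ J → ∃ t ≤ δ, shift t r ∈ I) ∧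
    ∀ s, Maximal (· ∈ J) s → shift (-(2 * δ)) s ∈ J → ∃ t ≤ δ, shift (-t) s ∈ I

/-- The point `p` witnesses that the diagonal has length at least `2δ` in `J`. Minimal points below
`p` and maximal points above `p + 2δ` then satisfy the length condition in `CornersReach`, and their
translates in `I` enclose the translates that are needed on the diagonal. -/
theorem CornersReach.diagClose {I J : PosetInterval n} {T : Set (Rbar n × Rbar n)} {δ : ℝ}
    (hδ : 0 ≤ δ) (h : CornersReach I.carrier J.carrier δ) (hT : RectDecomp J.carrier T)
    {x p : Rbar n} (hpx : p ∈ diag x) (hp : p ∈ J.carrier)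
    (hp' : shift (2 * δ) p ∈ J.carrier) : DiagClose J.carrier I.carrier δ x := by
  have main : ∀ q₁ ∈ diag x, ∀ q₂ ∈ diag x, q₁ ∈ J.carrier → q₂ ∈ J.carrier → q₁ ≤ p →
      shift (2 * δ) p ≤ q₂ → (∃ q ∈ diag x, q ∈ I.carrier ∧ q ≤ shift δ q₁) ∧
        ∃ q ∈ diag x, q ∈ I.carrier ∧ q₂ ≤ shift δ q := by
    intro q₁ hq₁x q₂ hq₂x hq₁ hq₂ hqp hpq
    obtain ⟨r, hr, hrq⟩ := hT.exists_minimal_le hq₁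
    obtain ⟨s, hs, hqs⟩ := hT.exists_maximal_ge hq₂
    have hrp : r ≤ p := hrq.trans hqp
    have hps : shift (2 * δ) p ≤ s := hpq.trans hqs
    have h2 : 0 ≤ 2 * δ := by positivity
    obtain ⟨t, ht, htI⟩ := h.1 r hr
      (J.convex _ hr.prop _ hp' _ (le_shift _ h2 r) (shift_mono _ hrp))
    -- The point `s - 2δ` is in `J` because `p ≤ s - 2δ ≤ s`.
    obtain ⟨v, hv, hvI⟩ := h.2 s hs (by
      refine J.convex _ hp _ hs.prop _ (shift_le_comm.1 hps) ?_
      simpa using shift_le_comm.2 (by simpa using le_shift _ h2 s))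
    -- Here `t + v ≤ 2δ` is used: going up by `t` from `p` stays below going down by `v` from `p +
    -- 2δ`.
    have hts : shift t p ≤ shift (-v) s := by
      calc shift t p ≤ shift (2 * δ - v) p := shift_le_shift (by linarith) p
        _ = shift (-v) (shift (2 * δ) p) := by rw [shift_shift]; ring_nf
        _ ≤ _ := shift_mono _ hps
    have hrv : shift t r ≤ shift (-v) (shift (2 * δ) p) := by
      rw [shift_shift]
      exact (shift_mono t hrp).trans (shift_le_shift (by linarith) p)
    refine ⟨⟨shift t q₁, shift_mem_diag hq₁x _, ?_, shift_le_shift ht _⟩,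
      ⟨shift (-v) q₂, shift_mem_diag hq₂x _, ?_, ?_⟩⟩
    · exact I.convex _ htI _ hvI _ (shift_mono t hrq) ((shift_mono t hqp).trans hts)
    · exact I.convex _ htI _ hvI _ (hrv.trans (shift_mono _ hpq)) (shift_mono _ hqs)
    · rw [shift_shift]
      exact le_shift _ (by linarith) _
  intro q hqx hq
  have hp'x := shift_mem_diag hpx (2 * δ)
  constructor
  · rcases le_total_of_mem_diag hqx hpx with hqp | hqp
    · exact (main q hqx _ hp'x hq hp' hqp le_rfl).1
    · obtain ⟨y, hyx, hy, hyp⟩ := (main p hpx _ hp'x hp hp' le_rfl le_rfl).1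
      exact ⟨y, hyx, hy, hyp.trans (shift_mono _ hqp)⟩
  · rcases le_total_of_mem_diag hqx hp'x with hqp | hqp
    · obtain ⟨y, hyx, hy, hyp⟩ := (main p hpx _ hp'x hp hp' le_rfl le_rfl).2
      exact ⟨y, hyx, hy, hqp.trans hyp⟩
    · exact (main p hpx q hqx hp hq le_rfl hqp).2

/-- A long segment of `J` alone gives closeness in both directions. A point `q` of `I` either is
within reach of `p` or `p + 2δ`, or lies so far out that `I` itself has length `2δ` on this
diagonal, and then the reverse corner condition applies. -/
theorem CornersReach.diagClose_both {I J : PosetInterval n} {S T : Set (Rbar n × Rbar n)}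
    {δ : ℝ} (hδ : 0 ≤ δ) (hIJ : CornersReach I.carrier J.carrier δ)
    (hJI : CornersReach J.carrier I.carrier δ) (hS : RectDecomp I.carrier S)
    (hT : RectDecomp J.carrier T) {x p : Rbar n} (hpx : p ∈ diag x) (hp : p ∈ J.carrier)
    (hp' : shift (2 * δ) p ∈ J.carrier) :
    DiagClose J.carrier I.carrier δ x ∧ DiagClose I.carrier J.carrier δ x := by
  have hJ := hIJ.diagClose hδ hT hpx hp hp'
  have hp'x := shift_mem_diag hpx (2 * δ)
  obtain ⟨⟨y, hyx, hy, hyp⟩, -⟩ := hJ p hpx hp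
  obtain ⟨-, ⟨z, hzx, hz, hpz⟩⟩ := hJ _ hp'x hp'
  have h2 : 0 ≤ 2 * δ := by positivity
  refine ⟨hJ, fun q hqx hq => ⟨?_, ?_⟩⟩
  · rcases le_total_of_mem_diag hpx (shift_mem_diag hqx δ) with h | h
    · exact ⟨p, hpx, hp, h⟩
    -- From `q + δ ≤ p` and `p + δ ≤ z` follows `q + 2δ ≤ z`, so `q + 2δ` is in `I` by convexity.
    · have hq' : shift (2 * δ) q ≤ z := by
        have h3 := shift_mono δ h
        have hpz : shift (-δ + 2 * δ) p ≤ z := by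
          rw [← shift_shift]
          simpa using shift_le_comm.2 (by simpa using hpz)
        rw [shift_shift, ← two_mul] at h3
        exact h3.trans (le_of_eq_of_le (by ring_nf) hpz)
      exact (hJI.diagClose hδ hS hqx hq
        (I.convex _ hq _ hz _ (le_shift _ h2 q) hq') q hqx hq).1
  · rcases le_total_of_mem_diag hqx (shift_mem_diag hp'x δ) with h | h
    · exact ⟨_, hp'x, hp', h⟩
    · have hq' : shift (2 * δ) y ≤ q := by
        refine le_trans ?_ h
        have h3 := shift_mono (2 * δ) hyp
        rw [shift_shift] at h3 ⊢
        rwa [add_comm δ]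
      exact (hJI.diagClose hδ hS hyx hy
        (I.convex _ hy _ hq _ (le_shift _ h2 y) hq') q hqx hq).2

theorem CornersReach.interleaved {I J : PosetInterval n} {S T : Set (Rbar n × Rbar n)}
    {δ : ℝ≥0} (hIJ : CornersReach I.carrier J.carrier δ)
    (hJI : CornersReach J.carrier I.carrier δ) (hS : RectDecomp I.carrier S)
    (hT : RectDecomp J.carrier T) (x : Rbar n) :
    Interleaved δ (slice (intervalModule K I) x) (slice (intervalModule K J) x) := by
  by_cases hJ : ∃ p ∈ diag x, p ∈ J.carrier ∧ shift (2 * (δ : ℝ)) p ∈ J.carrier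
  · obtain ⟨p, hpx, hp, hp'⟩ := hJ
    have := hIJ.diagClose_both δ.2 hJI hS hT hpx hp hp'
    exact interleaved_of_diagClose this.2 this.1
  by_cases hI : ∃ p ∈ diag x, p ∈ I.carrier ∧ shift (2 * (δ : ℝ)) p ∈ I.carrier
  · obtain ⟨p, hpx, hp, hp'⟩ := hI
    have := hJI.diagClose_both δ.2 hIJ hT hS hpx hp hp'
    exact interleaved_of_diagClose this.1 this.2
  push Not at hI hJ
  exact interleaved_of_forall_notMem hI hJ

/-- If the slices at `x` have interleaving distance less than `δ`, then for some `e < δ`, points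
of `Δ_x` that stay in `I` under the shift by `2e` are carried into `J` by the shift by `e`. -/
theorem exists_shift_mem_of_interleavingDist_lt {I J : PosetInterval n} {x : Rbar n} {δ : ℝ}
    (h : interleavingDist (slice (intervalModule K I) x) (slice (intervalModule K J) x)
      < ENNReal.ofReal δ) :
    ∃ e : ℝ, 0 ≤ e ∧ e < δ ∧ ∀ p ∈ diag x, p ∈ I.carrier → shift (2 * e) p ∈ I.carrier →
      shift e p ∈ J.carrier := by
  simp only [interleavingDist, iInf_lt_iff] at h
  obtain ⟨e, he, hlt⟩ := h
  refine ⟨e, e.2, ?_, fun p hpx hp hp' => he.shift_mem hpx hp hp'⟩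
  rw [← ENNReal.ofReal_coe_nnreal] at hlt
  exact (ENNReal.ofReal_lt_ofReal_iff_of_nonneg e.2).1 hlt

theorem interleavingDist_le_deltaStar (M N : Rbar n ⥤ ModuleCat.{u} K) (x : Rbar n) :
    interleavingDist (slice M x) (slice N x) ≤ deltaStar M N :=
  le_iInf₂ fun δ h => iInf₂_le δ (h x)

theorem CornersReach.deltaStar_le {I J : PosetInterval n} {S T : Set (Rbar n × Rbar n)}
    {δ : ℝ} (hδ : 0 ≤ δ) (hIJ : CornersReach I.carrier J.carrier δ)
    (hJI : CornersReach J.carrier I.carrier δ) (hS : RectDecomp I.carrier S)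
    (hT : RectDecomp J.carrier T) :
    deltaStar (intervalModule K I) (intervalModule K J) ≤ ENNReal.ofReal δ := by
  lift δ to ℝ≥0 using hδ
  rw [ENNReal.ofReal_coe_nnreal]
  exact iInf₂_le δ fun x => hIJ.interleaved hJI hS hT x

end Interleaving

/-! ## Corners are vertices and span facets -/

section Corners

variable {n : ℕ} {I : Set (Rbar n)} {T : Set (Rbar n × Rbar n)} {r : Rbar n}

/-- A rectangle that contains the minimal point `r` has `r` as its lower endpoint; the finitely many
other rectangles are closed and miss a neighbourhood of `r`. -/
theorem RectDecomp.eventually_ge (h : RectDecomp I T) (hr : Minimal (· ∈ I) r) :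
    ∀ᶠ y in 𝓝 r, y ∈ I → r ≤ y := by
  have h1 : ∀ p ∈ T, ∀ᶠ y in 𝓝 r, p.1 ≤ y ∧ y ≤ p.2 → r ≤ y := by
    intro p hp
    by_cases hrp : r ∈ Icc p.1 p.2
    · have := hr.eq_of_le (h.fst_mem hp) hrp.1
      exact .of_forall fun y hy => this ▸ hy.1
    · filter_upwards [isClosed_Icc.isOpen_compl.mem_nhds hrp] with y hy hy'
      exact absurd hy' hy
  filter_upwards [(eventually_all_finite h.finite).2 h1] with y hy hyI
  obtain ⟨p, hp, hyp⟩ := (h.mem_iff y).1 hyI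
  exact hy p hp hyp

theorem RectDecomp.eventually_le (h : RectDecomp I T) (hr : Maximal (· ∈ I) r) :
    ∀ᶠ y in 𝓝 r, y ∈ I → y ≤ r := by
  have h1 : ∀ p ∈ T, ∀ᶠ y in 𝓝 r, p.1 ≤ y ∧ y ≤ p.2 → y ≤ r := by
    intro p hp
    by_cases hrp : r ∈ Icc p.1 p.2
    · have := hr.eq_of_ge (h.snd_mem hp) hrp.2
      exact .of_forall fun y hy => this ▸ hy.2
    · filter_upwards [isClosed_Icc.isOpen_compl.mem_nhds hrp] with y hy hy'
      exact absurd hy' hy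
  filter_upwards [(eventually_all_finite h.finite).2 h1] with y hy hyI
  obtain ⟨p, hp, hyp⟩ := (h.mem_iff y).1 hyI
  exact hy p hp hyp

theorem tendsto_translateBy_smul (v : Fin n → ℝ) (x : Rbar n) :
    Tendsto (fun s : ℝ => translateBy (s • v) x) (𝓝 0) (𝓝 x) := by
  have h : Continuous fun s : ℝ => translateBy (s • v) x :=
    continuous_pi fun i => (continuous_coe_add (x i)).comp
      (continuous_id.mul continuous_const : Continuous fun s : ℝ => s * v i)
  have h0 : translateBy ((0 : ℝ) • v) x = x := by
    funext i
    simp [translateBy]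
  simpa only [h0] using h.tendsto 0

theorem add_coe_le_self_iff {c s : ℝ} : (c : EReal) + (s : EReal) ≤ c ↔ s ≤ 0 := by
  rw [← EReal.coe_add, EReal.coe_le_coe_iff]
  constructor <;> intro <;> linarith

theorem self_le_add_coe_iff {c s : ℝ} : (c : EReal) ≤ (c : EReal) + (s : EReal) ↔ 0 ≤ s := by
  rw [← EReal.coe_add, EReal.coe_le_coe_iff]
  constructor <;> intro <;> linarith

/-- Local invariance along `v` would put `r + s v` in the closure for small `s` of both signs. A
one-sided bound on the closure then forces each finite coordinate of `v` to vanish; at infinite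
coordinates `v` vanishes by assumption. -/
theorem mem_vertices_of_eventually {Q : Set (Rbar n)} (hrQ : r ∈ Q)
    (h : (∀ᶠ y in 𝓝 r, y ∈ closure Q → r ≤ y) ∨ ∀ᶠ y in 𝓝 r, y ∈ closure Q → y ≤ r) :
    r ∈ vertices Q := by
  have hrc : r ∈ closure Q := subset_closure hrQ
  refine ⟨hrc, fun v hv hv0 hinv => hv0 (funext fun i => ?_)⟩
  rcases eq_top_or_bot_or_coe (r i) with hi | hi | ⟨c, hc⟩
  · exact hv i (.inl hi)
  · exact hv i (.inr hi)
  have h0 : Tendsto (fun s : ℝ => (r, s)) (𝓝 0) (𝓝 (r, 0)) :=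
    (Continuous.prodMk_right r).tendsto 0
  have h1 : ∀ᶠ s : ℝ in 𝓝 0, translateBy (s • v) r ∈ closure Q :=
    (h0.eventually hinv).mono fun s hs => hs.1 hrc
  rcases h with h | h
  · have h2 : ∀ᶠ s : ℝ in 𝓝 0, 0 ≤ s * v i := by
      filter_upwards [h1, (tendsto_translateBy_smul v r).eventually h] with s hs hs'
      have := hs' hs i
      simpa only [translateBy, hc, self_le_add_coe_iff, Pi.smul_apply, smul_eq_mul] using this
    obtain ⟨ε, hε, h3⟩ := Metric.eventually_nhds_iff.1 h2
    have h4 := @h3 (ε / 2) (by rw [Real.dist_eq, sub_zero, abs_of_pos] <;> linarith)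
    have h5 := @h3 (-(ε / 2)) (by rw [Real.dist_eq, sub_zero, abs_neg, abs_of_pos] <;> linarith)
    have : ε / 2 * v i = 0 := by linarith
    exact (mul_eq_zero.1 this).resolve_left (by positivity)
  · have h2 : ∀ᶠ s : ℝ in 𝓝 0, s * v i ≤ 0 := by
      filter_upwards [h1, (tendsto_translateBy_smul v r).eventually h] with s hs hs'
      have := hs' hs i
      simpa only [translateBy, hc, add_coe_le_self_iff, Pi.smul_apply, smul_eq_mul] using this
    obtain ⟨ε, hε, h3⟩ := Metric.eventually_nhds_iff.1 h2
    have h4 := @h3 (ε / 2) (by rw [Real.dist_eq, sub_zero, abs_of_pos] <;> linarith)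
    have h5 := @h3 (-(ε / 2)) (by rw [Real.dist_eq, sub_zero, abs_neg, abs_of_pos] <;> linarith)
    have : ε / 2 * v i = 0 := by linarith
    exact (mul_eq_zero.1 this).resolve_left (by positivity)

/-- The one-sided bound at a corner passes to subsets, so this covers both `I` itself and the sets
`/f/ ∩ f`. -/
theorem RectDecomp.mem_vertices_of_subset (h : RectDecomp I T) (hr : r ∈ corners I)
    {Q : Set (Rbar n)} (hrQ : r ∈ Q) (hQ : Q ⊆ I) : r ∈ vertices Q := by
  have hc : closure Q ⊆ I := h.isClosed.closure_subset_iff.2 hQ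
  rcases hr with hr | hr
  · exact mem_vertices_of_eventually hrQ
      (.inl ((h.eventually_ge hr).mono fun y hy hyQ => hy (hc hyQ)))
  · exact mem_vertices_of_eventually hrQ
      (.inr ((h.eventually_le hr).mono fun y hy hyQ => hy (hc hyQ)))

theorem mem_of_mem_corners (hr : r ∈ corners I) : r ∈ I := hr.elim (·.prop) (·.prop)

theorem RectDecomp.corners_subset_vertices (h : RectDecomp I T) : corners I ⊆ vertices I :=
  fun _ hr => h.mem_vertices_of_subset hr (mem_of_mem_corners hr) subset_rfl

theorem mem_lowerBd_of_minimal (hn : 1 ≤ n) (hr : Minimal (· ∈ I) r) : r ∈ lowerBd I := by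
  refine ⟨subset_closure hr.prop, fun y hy hyI => ?_⟩
  exact (hy ⟨0, hn⟩).not_ge (hr.le_of_le hyI (fun i => (hy i).le) _)

theorem mem_upperBd_of_maximal (hn : 1 ≤ n) (hr : Maximal (· ∈ I) r) : r ∈ upperBd I := by
  refine ⟨subset_closure hr.prop, fun y hy hyI => ?_⟩
  exact (hy ⟨0, hn⟩).not_ge (hr.le_of_ge hyI (fun i => (hy i).le) _)

theorem isRectangle_Icc_update {a b : Rbar n} (i : Fin n) (h : ∀ j, a j < b j) :
    IsRectangle (n - 1) (Icc a (Function.update b i (a i))) ∧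
      IsRectangle (n - 1) (Icc (Function.update a i (b i)) b) := by
  have hc : ({i}ᶜ : Set (Fin n)).ncard = n - 1 := by
    rw [Set.ncard_compl, Set.ncard_singleton, Nat.card_eq_fintype_card, Fintype.card_fin]
  refine ⟨⟨_, _, fun j => ?_, ?_, rfl⟩, ⟨_, _, fun j => ?_, ?_, rfl⟩⟩
  · by_cases hj : j = i
    · subst hj; simp
    · simp [hj, (h j).le]
  · rw [← hc]
    congr 1
    ext j
    by_cases hj : j = i
    · subst hj; simp
    · simp [hj, (h j).ne]
  · by_cases hj : j = i
    · subst hj; simp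
    · simp [hj, (h j).le]
  · rw [← hc]
    congr 1
    ext j
    by_cases hj : j = i
    · subst hj; simp
    · simp [hj, (h j).ne]

theorem RectDecomp.isFacet_of_minimal (h : RectDecomp I T) (hr : Minimal (· ∈ I) r)
    (i : Fin n) : IsFacet I i (r i) (flat i (r i) ∩ lowerBd I) := by
  refine ⟨.inl rfl, ?_⟩
  obtain ⟨p, hp, hrp⟩ := h.exists_eq_fst hr
  have hlt : ∀ j, r j < p.2 j := fun j => hrp ▸ h.lt p hp j
  -- The bound `b j` is so close to `r j` that no lower endpoint has its `j`-th coordinate in `(r j,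
  -- b j]`. A rectangle reaching strictly below a point of the thin face then has its lower endpoint
  -- below `r`, against minimality.
  have h1 : ∀ j, ∃ b, r j < b ∧ b < p.2 j ∧ ∀ q ∈ T, r j < q.1 j → b < q.1 j := by
    intro j
    have hne : (𝓝[>] r j).NeBot := nhdsGT_neBot_of_exists_gt ⟨_, hlt j⟩
    have h2 : ∀ q ∈ T, ∀ᶠ b in 𝓝[>] r j, r j < q.1 j → b < q.1 j := by
      intro q _
      by_cases hq : r j < q.1 j
      · filter_upwards [Ioo_mem_nhdsGT hq] with b hb _ using hb.2
      · exact .of_forall fun b hb => absurd hb hq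
    obtain ⟨b, hb', hb⟩ :=
      (((eventually_all_finite h.finite).2 h2).and (Ioo_mem_nhdsGT (hlt j))).exists
    exact ⟨b, hb.1, hb.2, hb'⟩
  choose b hb hbp hbT using h1
  refine ⟨_, (isRectangle_Icc_update i hb).1, fun y hy => ?_⟩
  have hyi : y i = r i := le_antisymm (by simpa using hy.2 i) (hy.1 i)
  have hyb : ∀ j, j ≠ i → y j ≤ b j := fun j hj => by simpa [hj] using hy.2 j
  refine ⟨hyi, subset_closure ((h.mem_iff y).2 ⟨p, hp, hrp ▸ hy.1, fun j => ?_⟩), ?_⟩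
  · by_cases hj : j = i
    · subst hj
      rw [hyi]
      exact (hlt j).le
    · exact (hyb j hj).trans (hbp j).le
  · intro z hz hzI
    obtain ⟨q, hq, hqz, -⟩ := (h.mem_iff z).1 hzI
    have hqi : q.1 i < r i := hyi ▸ (hqz i).trans_lt (hz i)
    have hqr : q.1 ≤ r := fun j => by
      by_cases hj : j = i
      · subst hj
        exact hqi.le
      · by_contra hlt
        exact ((hbT j q hq (not_le.1 hlt)).trans_le
          ((hqz j).trans (hz j).le)).not_ge (hyb j hj)
    exact hqi.ne (congrFun (hr.eq_of_le (h.fst_mem hq) hqr) i)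

theorem RectDecomp.isFacet_of_maximal (h : RectDecomp I T) (hr : Maximal (· ∈ I) r)
    (i : Fin n) : IsFacet I i (r i) (flat i (r i) ∩ upperBd I) := by
  refine ⟨.inr rfl, ?_⟩
  obtain ⟨p, hp, hrp⟩ := h.exists_eq_snd hr
  have hlt : ∀ j, p.1 j < r j := fun j => hrp ▸ h.lt p hp j
  have h1 : ∀ j, ∃ b, b < r j ∧ p.1 j < b ∧ ∀ q ∈ T, q.2 j < r j → q.2 j < b := by
    intro j
    have hne : (𝓝[<] r j).NeBot := nhdsLT_neBot_of_exists_lt ⟨_, hlt j⟩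
    have h2 : ∀ q ∈ T, ∀ᶠ b in 𝓝[<] r j, q.2 j < r j → q.2 j < b := by
      intro q _
      by_cases hq : q.2 j < r j
      · filter_upwards [Ioo_mem_nhdsLT hq] with b hb _ using hb.1
      · exact .of_forall fun b hb => absurd hb hq
    obtain ⟨b, hb', hb⟩ :=
      (((eventually_all_finite h.finite).2 h2).and (Ioo_mem_nhdsLT (hlt j))).exists
    exact ⟨b, hb.2, hb.1, hb'⟩
  choose b hb hbp hbT using h1
  refine ⟨_, (isRectangle_Icc_update i hb).2, fun y hy => ?_⟩
  have hyi : y i = r i := le_antisymm (hy.2 i) (by simpa using hy.1 i)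
  have hyb : ∀ j, j ≠ i → b j ≤ y j := fun j hj => by simpa [hj] using hy.1 j
  refine ⟨hyi, subset_closure ((h.mem_iff y).2 ⟨p, hp, fun j => ?_, hrp ▸ hy.2⟩), ?_⟩
  · by_cases hj : j = i
    · subst hj
      rw [hyi]
      exact (hlt j).le
    · exact (hbp j).le.trans (hyb j hj)
  · intro z hz hzI
    obtain ⟨q, hq, -, hqz⟩ := (h.mem_iff z).1 hzI
    have hqi : r i < q.2 i := hyi ▸ (hz i).trans_le (hqz i)
    have hqr : r ≤ q.2 := fun j => by
      by_cases hj : j = i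
      · subst hj
        exact hqi.le
      · by_contra hlt
        exact ((hbT j q hq (not_le.1 hlt)).trans_le
          (hyb j hj)).not_ge ((hz j).le.trans (hqz j))
    exact hqi.ne' (congrFun (hr.eq_of_ge (h.snd_mem hq) hqr) i)

/-- Through each corner there pass facets in all coordinate directions. -/
theorem RectDecomp.exists_isFacet (hn : 1 ≤ n) (h : RectDecomp I T) (hr : r ∈ corners I)
    (i : Fin n) : ∃ f, IsFacet I i (r i) f ∧ r ∈ f ∧ f ⊆ I := by
  rcases hr with hr | hr
  · refine ⟨_, h.isFacet_of_minimal hr i, ⟨rfl, mem_lowerBd_of_minimal hn hr⟩, fun y hy => ?_⟩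
    exact h.isClosed.closure_eq ▸ hy.2.1
  · refine ⟨_, h.isFacet_of_maximal hr i, ⟨rfl, mem_upperBd_of_maximal hn hr⟩, fun y hy => ?_⟩
    exact h.isClosed.closure_eq ▸ hy.2.1

theorem RectDecomp.corners_subset_Vbar (hn : 1 ≤ n) (h : RectDecomp I T) (J : Set (Rbar n)) :
    corners I ⊆ Vbar I J ∩ Vbar J I := by
  intro r hr
  obtain ⟨f, hf, hrf, hfI⟩ := h.exists_isFacet hn hr ⟨0, hn⟩
  have hf' : f ∈ facets I := ⟨_, _, hf⟩
  have hv : r ∈ vertices (sweep f ∩ f) :=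
    h.mem_vertices_of_subset hr ⟨⟨r, hrf, 0, (shift_zero r).symm⟩, hrf⟩
      (inter_subset_right.trans hfI)
  exact ⟨⟨f, .inl hf', f, .inl hf', hv⟩, ⟨f, .inr hf', f, .inr hf', hv⟩⟩

theorem RectDecomp.ne_top (h : RectDecomp I T) (hr : Minimal (· ∈ I) r) (i : Fin n) :
    r i ≠ ⊤ := by
  obtain ⟨p, hp, rfl⟩ := h.exists_eq_fst hr
  exact ((h.lt p hp i).trans_le le_top).ne

theorem RectDecomp.ne_bot (h : RectDecomp I T) (hr : Maximal (· ∈ I) r) (i : Fin n) :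
    r i ≠ ⊥ := by
  obtain ⟨p, hp, rfl⟩ := h.exists_eq_snd hr
  exact (bot_le.trans_lt (h.lt p hp i)).ne'

end Corners

/-! ## Points where a diagonal enters or leaves an interval -/

section Exits

variable {n : ℕ}

/-- Diagonal shifts fix infinite coordinates, so strict room is needed only at the finite ones. -/
theorem exists_le_shift_neg {y p : Rbar n} (hyp : y ≤ p)
    (h : ∀ i, ∀ c : ℝ, p i = c → y i < p i) : ∃ ε > 0, y ≤ shift (-ε) p := by
  have h1 : ∀ᶠ ε : ℝ in 𝓝[>] 0, ∀ i, y i ≤ shift (-ε) p i := by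
    refine eventually_all.2 fun i => ?_
    rcases eq_top_or_bot_or_coe (p i) with hi | hi | ⟨c, hc⟩
    · exact .of_forall fun ε => by simp [shift_apply, hi]
    · exact .of_forall fun ε => by simpa [shift_apply, hi] using hyp i
    · have hc' : Continuous fun ε : ℝ => p i + ((-ε : ℝ) : EReal) :=
        (continuous_coe_add (p i)).comp continuous_neg
      refine ((hc'.tendsto 0).eventually_const_lt ?_).filter_mono
        nhdsWithin_le_nhds |>.mono fun _ h => h.le
      simpa using h i c hc
  obtain ⟨ε, h2, hε⟩ := (h1.and self_mem_nhdsWithin).exists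
  exact ⟨ε, hε, h2⟩

theorem exists_shift_le {y p : Rbar n} (hyp : p ≤ y)
    (h : ∀ i, ∀ c : ℝ, p i = c → p i < y i) : ∃ ε > 0, shift ε p ≤ y := by
  have h1 : ∀ᶠ ε : ℝ in 𝓝[>] 0, ∀ i, shift ε p i ≤ y i := by
    refine eventually_all.2 fun i => ?_
    rcases eq_top_or_bot_or_coe (p i) with hi | hi | ⟨c, hc⟩
    · exact .of_forall fun ε => by simpa [shift_apply, hi] using hyp i
    · exact .of_forall fun ε => by simp [shift_apply, hi]
    · refine (((continuous_coe_add (p i)).tendsto 0).eventually_lt_const ?_).filter_mono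
        nhdsWithin_le_nhds |>.mono fun _ h => h.le
      simpa using h i c hc
  obtain ⟨ε, h2, hε⟩ := (h1.and self_mem_nhdsWithin).exists
  exact ⟨ε, hε, h2⟩

/-- The diagonal through `p` enters `I` at `p`. -/
def IsEntry (I : Set (Rbar n)) (p : Rbar n) : Prop := p ∈ I ∧ ∀ ε > 0, shift (-ε) p ∉ I

/-- The diagonal through `p` leaves `I` at `p`. -/
def IsExit (I : Set (Rbar n)) (p : Rbar n) : Prop := p ∈ I ∧ ∀ ε > 0, shift ε p ∉ I

variable {I : PosetInterval n} {T : Set (Rbar n × Rbar n)} {p r : Rbar n} {τ : ℝ}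

theorem IsEntry.mem_lowerBd (h : IsEntry I.carrier p) : p ∈ lowerBd I.carrier := by
  refine ⟨subset_closure h.1, fun y hy hyI => ?_⟩
  obtain ⟨ε, hε, h1⟩ := exists_le_shift_neg (fun i => (hy i).le) fun i _ _ => hy i
  refine h.2 ε hε (I.convex _ hyI _ h.1 _ h1 ?_)
  simpa using shift_le_shift (neg_nonpos.2 (le_of_lt hε)) p |>.trans_eq (shift_zero p)

theorem IsExit.mem_upperBd (h : IsExit I.carrier p) : p ∈ upperBd I.carrier := by
  refine ⟨subset_closure h.1, fun y hy hyI => ?_⟩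
  obtain ⟨ε, hε, h1⟩ := exists_shift_le (fun i => (hy i).le) fun i _ _ => hy i
  exact h.2 ε hε (I.convex _ h.1 _ hyI _ (le_shift _ (le_of_lt hε) p) h1)

/-- If a minimal `r ≤ p` were strictly below `p` in every finite coordinate, then `r ≤ p - ε` for
some `ε > 0`, and convexity would put `p - ε` in `I`. The shared coordinate identifies a facet flat
through the entry point. -/
theorem IsEntry.exists_minimal (h : IsEntry I.carrier p) (hT : RectDecomp I.carrier T) :
    ∃ i, (∃ c : ℝ, p i = c) ∧ ∃ r, Minimal (· ∈ I.carrier) r ∧ r i = p i := by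
  obtain ⟨r, hr, hrp⟩ := hT.exists_minimal_le h.1
  by_contra! hcon
  obtain ⟨ε, hε, h1⟩ := exists_le_shift_neg hrp
    fun i c hc => (hrp i).lt_of_ne (hcon i ⟨c, hc⟩ r hr)
  refine h.2 ε hε (I.convex _ hr.prop _ h.1 _ h1 ?_)
  simpa using shift_le_shift (neg_nonpos.2 (le_of_lt hε)) p |>.trans_eq (shift_zero p)

theorem IsExit.exists_maximal (h : IsExit I.carrier p) (hT : RectDecomp I.carrier T) :
    ∃ i, (∃ c : ℝ, p i = c) ∧ ∃ r, Maximal (· ∈ I.carrier) r ∧ r i = p i := by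
  obtain ⟨r, hr, hrp⟩ := hT.exists_maximal_ge h.1
  by_contra! hcon
  obtain ⟨ε, hε, h1⟩ := exists_shift_le hrp
    fun i c hc => (hrp i).lt_of_ne (hcon i ⟨c, hc⟩ r hr).symm
  exact h.2 ε hε (I.convex _ h.1 _ hr.prop _ (le_shift _ (le_of_lt hε) p) h1)

theorem IsEntry.le_of_mem {I : Set (Rbar n)} (h : IsEntry I (shift τ r)) {t : ℝ}
    (ht : shift t r ∈ I) : τ ≤ t := by
  by_contra! hlt
  refine h.2 (τ - t) (sub_pos.2 hlt) ?_
  rwa [shift_shift, neg_sub, sub_add_cancel]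

theorem IsExit.le_of_mem {I : Set (Rbar n)} (h : IsExit I (shift τ r)) {t : ℝ}
    (ht : shift t r ∈ I) : t ≤ τ := by
  by_contra! hlt
  refine h.2 (t - τ) (sub_pos.2 hlt) ?_
  rwa [shift_shift, sub_add_cancel]

theorem exists_coe_of_shift {i : Fin n} {c : ℝ} (h : shift τ r i = c) :
    ∃ d : ℝ, r i = d := by
  rcases eq_top_or_bot_or_coe (r i) with hi | hi | hi
  · simp [shift_apply, hi] at h
  · simp [shift_apply, hi] at h
  · exact hi

end Exits

/-! ## Diagonal distances -/

section Distances

variable {n : ℕ} {x r : Rbar n} {τ : ℝ}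

theorem dInfty_self (x : Rbar n) : dInfty x x = 0 := by simp [dInfty]

theorem dInfty_shift {i : Fin n} {c : ℝ} (h : x i = c) (t : ℝ) :
    dInfty x (shift t x) = ENNReal.ofReal |t| := by
  classical
  have key : ∀ (d : ℝ), (if (d : EReal) = d + (t : EReal) then 0
      else ((d : EReal) - (d + (t : EReal))).abs) = ENNReal.ofReal |t| := by
    intro d
    rw [← EReal.coe_add, ← EReal.coe_sub, EReal.abs_def]
    split_ifs with h0
    · rw [EReal.coe_eq_coe_iff] at h0
      have : t = 0 := by linarith
      simp [this]
    · simp [abs_neg]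
  refine le_antisymm (iSup_le fun j => ?_) (le_iSup_of_le i ?_)
  · rw [shift_apply]
    rcases eq_top_or_bot_or_coe (x j) with hj | hj | ⟨d, hd⟩
    · simp [hj]
    · simp [hj]
    · rw [hd]
      exact (key d).le
  · rw [shift_apply, h]
    exact (key c).ge

theorem dl_eq {A : Set (Rbar n)} {i : Fin n} {c : ℝ} (hi : x i = c) (hτ : shift τ x ∈ A)
    (h : ∀ t, shift t x ∈ A → |τ| ≤ |t|) : dl x A = ENNReal.ofReal |τ| := by
  refine le_antisymm ?_ (le_iInf₂ ?_)
  · rw [← dInfty_shift hi]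
    exact iInf₂_le _ ⟨⟨τ, rfl⟩, hτ⟩
  · rintro y ⟨⟨t, rfl⟩, ht⟩
    rw [dInfty_shift hi]
    exact ENNReal.ofReal_le_ofReal (h t ht)

theorem dl_eq_zero {A : Set (Rbar n)} (h : x ∈ A) : dl x A = 0 :=
  nonpos_iff_eq_zero.1 (dInfty_self x ▸ iInf₂_le x ⟨self_mem_diag x, h⟩)

theorem exists_shift_mem_of_dl_ne_top {A : Set (Rbar n)} (h : dl x A ≠ ⊤) :
    ∃ t, shift t x ∈ A := by
  by_contra! hA
  refine h (iInf₂_eq_top.2 ?_)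
  rintro y ⟨⟨t, rfl⟩, ht⟩
  exact absurd ht (hA t)

theorem dl_flat {i : Fin n} {c : ℝ} (h : shift τ x i = c) :
    dl x (flat i (shift τ x i)) = ENNReal.ofReal |τ| := by
  obtain ⟨d, hd⟩ := exists_coe_of_shift h
  refine dl_eq hd rfl fun t ht => ?_
  have ht' : x i + (t : EReal) = x i + (τ : EReal) := ht
  rw [hd, ← EReal.coe_add, ← EReal.coe_add, EReal.coe_eq_coe_iff, add_right_inj] at ht'
  rw [ht']

variable {I : PosetInterval n} {T : Set (Rbar n × Rbar n)}

theorem IsEntry.dl_lowerBd (h : IsEntry I.carrier (shift τ r)) (hτ : 0 ≤ τ)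
    (hT : RectDecomp I.carrier T) : dl r (lowerBd I.carrier) = ENNReal.ofReal |τ| := by
  obtain ⟨i, ⟨c, hc⟩, -⟩ := h.exists_minimal hT
  obtain ⟨d, hd⟩ := exists_coe_of_shift hc
  refine dl_eq hd h.mem_lowerBd fun t ht => abs_le_abs_of_nonneg hτ (h.le_of_mem ?_)
  exact hT.isClosed.closure_eq ▸ ht.1

theorem IsExit.dl_upperBd (h : IsExit I.carrier (shift (-τ) r)) (hτ : 0 ≤ τ)
    (hT : RectDecomp I.carrier T) : dl r (upperBd I.carrier) = ENNReal.ofReal |τ| := by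
  obtain ⟨i, ⟨c, hc⟩, -⟩ := h.exists_maximal hT
  obtain ⟨d, hd⟩ := exists_coe_of_shift hc
  rw [← abs_neg]
  refine dl_eq hd h.mem_upperBd fun t ht => ?_
  have : t ≤ -τ := h.le_of_mem (hT.isClosed.closure_eq ▸ ht.1)
  rw [abs_neg, abs_of_nonneg hτ]
  exact (by linarith : τ ≤ -t).trans (neg_le_abs t)

/-- Nearer points of the diagonal, on either side of `r`, are strictly below the upper endpoint of a
rectangle containing the exit point, hence not in the upper boundary. Coordinates of `r` equal to
`⊤`, which would spoil strictness, cannot occur at a minimal point. -/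
theorem IsExit.dl_upperBd_of_minimal (h : IsExit I.carrier (shift τ r)) (hτ : 0 ≤ τ)
    (hT : RectDecomp I.carrier T) (hr : Minimal (· ∈ I.carrier) r) :
    dl r (upperBd I.carrier) = ENNReal.ofReal |τ| := by
  obtain ⟨i, ⟨c, hc⟩, -⟩ := h.exists_maximal hT
  obtain ⟨d, hd⟩ := exists_coe_of_shift hc
  refine dl_eq hd h.mem_upperBd fun t ht => abs_le_abs_of_nonneg hτ ?_
  by_contra! hlt
  obtain ⟨p, hp, -, hp2⟩ := (hT.mem_iff _).1 h.1
  refine ht.2 p.2 (fun j => ?_) (hT.snd_mem hp)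
  rcases eq_top_or_bot_or_coe (r j) with hj | hj | ⟨a, ha⟩
  · exact absurd hj (hT.ne_top hr j)
  · rw [shift_apply, hj, EReal.bot_add]
    exact bot_le.trans_lt (hT.lt p hp j)
  · refine lt_of_lt_of_le ?_ (hp2 j)
    rw [shift_apply, shift_apply, ha, ← EReal.coe_add, ← EReal.coe_add, EReal.coe_lt_coe_iff]
    linarith

theorem IsEntry.dl_lowerBd_of_maximal (h : IsEntry I.carrier (shift (-τ) r)) (hτ : 0 ≤ τ)
    (hT : RectDecomp I.carrier T) (hr : Maximal (· ∈ I.carrier) r) :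
    dl r (lowerBd I.carrier) = ENNReal.ofReal |τ| := by
  obtain ⟨i, ⟨c, hc⟩, -⟩ := h.exists_minimal hT
  obtain ⟨d, hd⟩ := exists_coe_of_shift hc
  rw [← abs_neg]
  refine dl_eq hd h.mem_lowerBd fun t ht => ?_
  rw [abs_neg, abs_of_nonneg hτ]
  refine le_trans ?_ (neg_le_abs t)
  by_contra! hlt
  obtain ⟨p, hp, hp2, -⟩ := (hT.mem_iff _).1 h.1
  refine ht.2 p.1 (fun j => ?_) (hT.fst_mem hp)
  rcases eq_top_or_bot_or_coe (r j) with hj | hj | ⟨a, ha⟩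
  · rw [shift_apply, hj, EReal.top_add_coe]
    exact (hT.lt p hp j).trans_le le_top
  · exact absurd hj (hT.ne_bot hr j)
  · refine lt_of_le_of_lt (hp2 j) ?_
    rw [shift_apply, shift_apply, ha, ← EReal.coe_add, ← EReal.coe_add, EReal.coe_lt_coe_iff]
    linarith

end Distances

/-! ## Finiteness of the vertex sets -/

section Grid

variable {n : ℕ} {G : Set ℝ}

/-- The values in `G`, together with `±∞`. -/
def extValues (G : Set ℝ) : Set EReal := {c | c = ⊤ ∨ c = ⊥ ∨ ∃ g ∈ G, c = (g : ℝ)}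

theorem finite_extValues (hG : G.Finite) : (extValues G).Finite := by
  refine (((hG.image Real.toEReal).insert ⊥).insert ⊤).subset ?_
  rintro c (rfl | rfl | ⟨g, hg, rfl⟩)
  · simp
  · simp
  · exact .inr (.inr (mem_image_of_mem _ hg))

/-- Corresponding coordinates of `y` and `y'` have the same position relative to `G` and
`±∞`. -/
def SamePos (G : Set ℝ) (y y' : Rbar n) : Prop :=
  ∀ i, ∀ c ∈ extValues G, (y i < c ↔ y' i < c) ∧ (c < y i ↔ c < y' i)

theorem SamePos.symm {y y' : Rbar n} (h : SamePos G y y') : SamePos G y' y :=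
  fun i c hc => ⟨(h i c hc).1.symm, (h i c hc).2.symm⟩

theorem SamePos.eq_iff {y y' : Rbar n} (h : SamePos G y y') {i : Fin n} {c : EReal}
    (hc : c ∈ extValues G) : y i = c ↔ y' i = c := by
  have := h i c hc
  rw [← not_iff_not, ← ne_eq, ← ne_eq, lt_or_lt_iff_ne.symm, lt_or_lt_iff_ne.symm, this.1,
    this.2]

/-- Differences of corresponding coordinates of `p` and `p'` have the same position relative
to the differences of `G`. -/
def SameDiffPos (G : Set ℝ) (p p' : Rbar n) : Prop :=
  ∀ i j, ∀ g ∈ G, ∀ h ∈ G,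
    (p i + (h : EReal) < p j + (g : EReal) ↔ p' i + (h : EReal) < p' j + (g : EReal))

theorem SameDiffPos.symm {y y' : Rbar n} (h : SameDiffPos G y y') : SameDiffPos G y' y :=
  fun i j g hg k hk => (h i j g hg k hk).symm

/-- `Q` is a union of cells of the grid of hyperplanes `{xᵢ = g}`, with `g ∈ G`. -/
def IsGridSet (G : Set ℝ) (Q : Set (Rbar n)) : Prop := ∀ y y', SamePos G y y' → y ∈ Q → y' ∈ Q

theorem IsGridSet.inter {Q Q' : Set (Rbar n)} (h : IsGridSet G Q) (h' : IsGridSet G Q') :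
    IsGridSet G (Q ∩ Q') := fun y y' hy hyQ => ⟨h y y' hy hyQ.1, h' y y' hy hyQ.2⟩

theorem isGridSet_flat (i : Fin n) {c : EReal} (hc : c ∈ extValues G) :
    IsGridSet G (flat i c) := fun _ _ h hy => (h.eq_iff hc).1 hy

/-- All coordinates of the corners of the rectangles in `T` are in `G` or infinite. -/
def GridCoords (G : Set ℝ) (T : Set (Rbar n × Rbar n)) : Prop :=
  ∀ p ∈ T, ∀ i, p.1 i ∈ extValues G ∧ p.2 i ∈ extValues G

theorem exists_gridCoords {T : Set (Rbar n × Rbar n)} (hT : T.Finite) :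
    ∃ G : Set ℝ, G.Finite ∧ GridCoords G T := by
  refine ⟨⋃ p ∈ T, ⋃ i, {(p.1 i).toReal, (p.2 i).toReal},
    hT.biUnion fun p _ => finite_iUnion fun i => by simp, fun p hp i => ?_⟩
  have key : ∀ c : EReal, c = p.1 i ∨ c = p.2 i →
      c ∈ extValues (⋃ p ∈ T, ⋃ i, {(p.1 i).toReal, (p.2 i).toReal}) := by
    intro c hc
    rcases eq_top_or_bot_or_coe c with h | h | ⟨d, hd⟩
    · exact .inl h
    · exact .inr (.inl h)
    · refine .inr (.inr ⟨d, ?_, hd⟩)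
      simp only [mem_iUnion]
      refine ⟨p, hp, i, ?_⟩
      rcases hc with hc | hc
      · left
        rw [← hc, hd, EReal.toReal_coe]
      · right
        rw [mem_singleton_iff, ← hc, hd, EReal.toReal_coe]
  exact ⟨key _ (.inl rfl), key _ (.inr rfl)⟩

theorem GridCoords.mono {G' : Set ℝ} {T : Set (Rbar n × Rbar n)} (h : GridCoords G T)
    (hG : G ⊆ G') : GridCoords G' T := by
  have : extValues G ⊆ extValues G' := fun c hc =>
    hc.imp_right (Or.imp_right fun ⟨g, hg, h⟩ => ⟨g, hG hg, h⟩)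
  exact fun p hp i => ⟨this (h p hp i).1, this (h p hp i).2⟩

variable {I : Set (Rbar n)} {T : Set (Rbar n × Rbar n)}

/-! ### Boundaries and facets as unions of grid cells. -/

theorem RectDecomp.mem_lowerBd_iff (h : RectDecomp I T) (x : Rbar n) :
    x ∈ lowerBd I ↔ x ∈ I ∧ ∀ p ∈ T, ∃ i, x i ≤ p.1 i := by
  rw [lowerBd, h.isClosed.closure_eq]
  refine and_congr_right fun _ => ⟨fun hx p hp => ?_, fun hx y hy hyI => ?_⟩
  · by_contra! hlt
    exact hx _ hlt (h.fst_mem hp)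
  · obtain ⟨p, hp, hpy, -⟩ := (h.mem_iff y).1 hyI
    obtain ⟨i, hi⟩ := hx p hp
    exact ((hpy i).trans_lt (hy i)).not_ge hi

theorem RectDecomp.mem_upperBd_iff (h : RectDecomp I T) (x : Rbar n) :
    x ∈ upperBd I ↔ x ∈ I ∧ ∀ p ∈ T, ∃ i, p.2 i ≤ x i := by
  rw [upperBd, h.isClosed.closure_eq]
  refine and_congr_right fun _ => ⟨fun hx p hp => ?_, fun hx y hy hyI => ?_⟩
  · by_contra! hlt
    exact hx _ hlt (h.snd_mem hp)
  · obtain ⟨p, hp, -, hpy⟩ := (h.mem_iff y).1 hyI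
    obtain ⟨i, hi⟩ := hx p hp
    exact ((hy i).trans_le (hpy i)).not_ge hi

theorem RectDecomp.isGridSet (h : RectDecomp I T) (hG : GridCoords G T) : IsGridSet G I := by
  intro y y' hy hyI
  obtain ⟨p, hp, h1, h2⟩ := (h.mem_iff y).1 hyI
  refine (h.mem_iff y').2 ⟨p, hp, fun i => ?_, fun i => ?_⟩
  · exact not_lt.1 fun h' => (h1 i).not_gt ((hy i _ (hG p hp i).1).1.2 h')
  · exact not_lt.1 fun h' => (h2 i).not_gt ((hy i _ (hG p hp i).2).2.2 h')

theorem RectDecomp.isGridSet_lowerBd (h : RectDecomp I T) (hG : GridCoords G T) :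
    IsGridSet G (lowerBd I) := by
  intro y y' hy hyI
  rw [h.mem_lowerBd_iff] at hyI ⊢
  refine ⟨h.isGridSet hG _ _ hy hyI.1, fun p hp => ?_⟩
  obtain ⟨i, hi⟩ := hyI.2 p hp
  exact ⟨i, not_lt.1 fun h' => hi.not_gt ((hy i _ (hG p hp i).1).2.2 h')⟩

theorem RectDecomp.isGridSet_upperBd (h : RectDecomp I T) (hG : GridCoords G T) :
    IsGridSet G (upperBd I) := by
  intro y y' hy hyI
  rw [h.mem_upperBd_iff] at hyI ⊢
  refine ⟨h.isGridSet hG _ _ hy hyI.1, fun p hp => ?_⟩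
  obtain ⟨i, hi⟩ := hyI.2 p hp
  exact ⟨i, not_lt.1 fun h' => hi.not_gt ((hy i _ (hG p hp i).2).1.2 h')⟩

/-- The flat of a facet has its coordinate in the grid. -/
theorem RectDecomp.mem_extValues_of_isFacet (h : RectDecomp I T) (hGfin : G.Finite)
    (hG : GridCoords G T) {i : Fin n} {c : EReal} {f : Set (Rbar n)} (hf : IsFacet I i c f) :
    c ∈ extValues G := by
  obtain ⟨hf, R, ⟨a, b, hab, hcard, rfl⟩, hRf⟩ := hf
  by_contra hc
  have hflat : ∀ x ∈ Icc a b, x i = c := by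
    intro x hx
    rcases hf with rfl | rfl <;> exact (hRf hx).1
  have hai : a i = c := hflat a ⟨le_rfl, hab⟩
  have hbi : b i = c := hflat b ⟨hab, le_rfl⟩
  have hlt : ∀ j, j ≠ i → a j < b j := by
    intro j hj
    have h1 : {k | a k ≠ b k} = {i}ᶜ := by
      refine Set.eq_of_subset_of_ncard_le (fun k hk => ?_) ?_
      · rintro rfl
        exact hk (hai.trans hbi.symm)
      · rw [hcard, Set.ncard_compl, Set.ncard_singleton, Nat.card_eq_fintype_card,
          Fintype.card_fin]
    have h2 : j ∈ {k | a k ≠ b k} := h1 ▸ hj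
    exact (hab j).lt_of_ne h2
  -- If `c` is off the grid, the rectangle in the facet contains a point with no grid coordinate at
  -- all. Every rectangle of `T` around that point contains it strictly, so it is not a boundary
  -- point.
  have hx : ∀ j, ∃ y, a j ≤ y ∧ y ≤ b j ∧ y ∉ extValues G := by
    intro j
    by_cases hj : j = i
    · subst hj
      exact ⟨c, hai.le, hbi.ge, hc⟩
    · obtain ⟨y, hy, hy'⟩ := ((Ioo_infinite (hlt j hj)).sdiff (finite_extValues hGfin)).nonempty
      exact ⟨y, hy.1.le, hy.2.le, hy'⟩
  choose x hxa hxb hxG using hx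
  have hxR : x ∈ f := hRf ⟨hxa, hxb⟩
  have hne : ∀ p ∈ T, p.1 ≤ x → x ≤ p.2 → (∀ j, p.1 j < x j) ∧ ∀ j, x j < p.2 j := by
    intro p hp h1 h2
    refine ⟨fun j => (h1 j).lt_of_ne ?_, fun j => (h2 j).lt_of_ne ?_⟩
    · exact fun h' => hxG j (h' ▸ (hG p hp j).1)
    · exact fun h' => hxG j (h' ▸ (hG p hp j).2)
  rcases hf with rfl | rfl
  · obtain ⟨hxI, hxT⟩ := (h.mem_lowerBd_iff x).1 hxR.2
    obtain ⟨p, hp, h1, h2⟩ := (h.mem_iff x).1 hxI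
    obtain ⟨j, hj⟩ := hxT p hp
    exact ((hne p hp h1 h2).1 j).not_ge hj
  · obtain ⟨hxI, hxT⟩ := (h.mem_upperBd_iff x).1 hxR.2
    obtain ⟨p, hp, h1, h2⟩ := (h.mem_iff x).1 hxI
    obtain ⟨j, hj⟩ := hxT p hp
    exact ((hne p hp h1 h2).2 j).not_ge hj

theorem RectDecomp.isGridSet_of_isFacet (h : RectDecomp I T) (hGfin : G.Finite)
    (hG : GridCoords G T) {f : Set (Rbar n)} (hf : f ∈ facets I) : IsGridSet G f := by
  obtain ⟨i, c, hf⟩ := hf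
  have hc := isGridSet_flat i (h.mem_extValues_of_isFacet hGfin hG hf)
  rcases hf.1 with rfl | rfl
  · exact hc.inter (h.isGridSet_lowerBd hG)
  · exact hc.inter (h.isGridSet_upperBd hG)

/-- Two finite families in the same order have corresponding gaps; `t'` is taken in the gap, or at
the member, that corresponds to `t`. -/
theorem exists_same_order {ι : Type*} [Finite ι] {a a' : ι → ℝ}
    (h : ∀ k l, a k < a l ↔ a' k < a' l) (t : ℝ) :
    ∃ t', ∀ k, (t < a k ↔ t' < a' k) ∧ (a k < t ↔ a' k < t') := by
  classical
  have := Fintype.ofFinite ι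
  by_cases ht : ∃ k, a k = t
  · obtain ⟨k, rfl⟩ := ht
    exact ⟨a' k, fun l => ⟨h k l, h l k⟩⟩
  push Not at ht
  obtain ⟨t', h1, h2⟩ := Order.exists_between_finsets
    ((Finset.univ.filter fun k => a k < t).image a')
    ((Finset.univ.filter fun k => t < a k).image a') (by
      intro x hx y hy
      simp only [Finset.mem_image, Finset.mem_filter, Finset.mem_univ, true_and] at hx hy
      obtain ⟨k, hk, rfl⟩ := hx
      obtain ⟨l, hl, rfl⟩ := hy
      exact (h k l).1 (hk.trans hl))
  simp only [Finset.mem_image, Finset.mem_filter, Finset.mem_univ, true_and,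
    forall_exists_index, and_imp, forall_apply_eq_imp_iff₂] at h1 h2
  refine ⟨t', fun k => ?_⟩
  rcases (ht k).lt_or_gt with hk | hk
  · have := h1 k hk
    constructor <;> constructor <;> intro <;> linarith
  · have := h2 k hk
    constructor <;> constructor <;> intro <;> linarith

/-- Coordinate `i` of `p + t` crosses the grid value `g` at `t = g - p i`. The hypothesis on
differences says that these crossing times come in the same order for `p` and `p'`. -/
theorem SameDiffPos.exists_samePos_shift (hG : G.Finite) {p p' : Rbar n}
    (h : SamePos G p p') (hd : SameDiffPos G p p') (t : ℝ) :
    ∃ t', SamePos G (shift t p) (shift t' p') := by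
  have := hG.to_subtype
  have htop : ∀ i, p i = ⊤ ↔ p' i = ⊤ := fun i => h.eq_iff (.inl rfl)
  have hbot : ∀ i, p i = ⊥ ↔ p' i = ⊥ := fun i => h.eq_iff (.inr (.inl rfl))
  obtain ⟨t', ht'⟩ := exists_same_order
    (ι := {k : Fin n × G // p k.1 ≠ ⊤ ∧ p k.1 ≠ ⊥})
    (a := fun k => (k.1.2 : ℝ) - (p k.1.1).toReal)
    (a' := fun k => (k.1.2 : ℝ) - (p' k.1.1).toReal) (by
      rintro ⟨⟨i, g, hg⟩, hi1, hi2⟩ ⟨⟨j, k, hk⟩, hj1, hj2⟩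
      have h1 := hd j i k hk g hg
      have hi1' := fun h => hi1 ((htop i).2 h)
      have hi2' := fun h => hi2 ((hbot i).2 h)
      have hj1' := fun h => hj1 ((htop j).2 h)
      have hj2' := fun h => hj2 ((hbot j).2 h)
      dsimp only at *
      rw [← EReal.coe_toReal hi1 hi2, ← EReal.coe_toReal hj1 hj2,
        ← EReal.coe_toReal hi1' hi2', ← EReal.coe_toReal hj1' hj2', ← EReal.coe_add,
        ← EReal.coe_add, ← EReal.coe_add, ← EReal.coe_add, EReal.coe_lt_coe_iff,
        EReal.coe_lt_coe_iff] at h1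
      constructor <;> intro h2
      · linarith [h1.1 (by linarith)]
      · linarith [h1.2 (by linarith)]) t
  refine ⟨t', fun i c hc => ?_⟩
  rw [shift_apply, shift_apply]
  rcases eq_top_or_bot_or_coe (p i) with hi | hi | ⟨a, ha⟩
  · simp [hi, (htop i).1 hi]
  · simp [hi, (hbot i).1 hi]
  rcases eq_top_or_bot_or_coe (p' i) with hi | hi | ⟨a', ha'⟩
  · simp [(htop i).2 hi] at ha
  · simp [(hbot i).2 hi] at ha
  rw [ha, ha', ← EReal.coe_add, ← EReal.coe_add]
  rcases hc with rfl | rfl | ⟨g, hg, rfl⟩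
  · exact ⟨iff_of_true (EReal.coe_lt_top _) (EReal.coe_lt_top _),
      iff_of_false not_top_lt not_top_lt⟩
  · exact ⟨iff_of_false not_lt_bot not_lt_bot,
      iff_of_true (EReal.bot_lt_coe _) (EReal.bot_lt_coe _)⟩
  have h1 := ht' ⟨(i, ⟨g, hg⟩), by simp [ha]⟩
  simp only [ha, ha', EReal.toReal_coe] at h1
  simp only [EReal.coe_lt_coe_iff]
  constructor
  · rw [← lt_sub_iff_add_lt', ← lt_sub_iff_add_lt', h1.1]
  · rw [← sub_lt_iff_lt_add', ← sub_lt_iff_lt_add', h1.2]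

theorem mem_sweep_iff {f : Set (Rbar n)} {y : Rbar n} : y ∈ sweep f ↔ ∃ t, shift t y ∈ f := by
  constructor
  · rintro ⟨x, hx, t, rfl⟩
    exact ⟨-t, by rwa [shift_shift, neg_add_cancel, shift_zero]⟩
  · rintro ⟨t, ht⟩
    exact ⟨_, ht, -t, by rw [shift_shift, neg_add_cancel, shift_zero]⟩

theorem IsGridSet.mem_sweep {f : Set (Rbar n)} (hf : IsGridSet G f) (hG : G.Finite)
    {p p' : Rbar n} (h : SamePos G p p') (hd : SameDiffPos G p p') (hp : p ∈ sweep f) :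
    p' ∈ sweep f := by
  rw [mem_sweep_iff] at hp ⊢
  obtain ⟨t, ht⟩ := hp
  obtain ⟨t', ht'⟩ := hd.exists_samePos_shift hG h t
  exact ⟨t', hf _ _ ht' ht⟩

/-- `v` is tangent at `x` to the grid hyperplanes `{xᵢ = g}` and `{xᵢ - xⱼ = g - h}`, with
`g, h ∈ G`, that contain `x`, and vanishes at infinite coordinates of `x`. -/
def Tangent (G : Set ℝ) (x : Rbar n) (v : Fin n → ℝ) : Prop :=
  (∀ i, x i ∈ extValues G → v i = 0) ∧
    ∀ i j, ∀ g ∈ G, ∀ h ∈ G, x i + (h : EReal) = x j + (g : EReal) → v i = v j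

/-! ### Local invariance along tangent directions. -/

theorem tendsto_translateBy_apply (x : Rbar n) (v : Fin n → ℝ) (i : Fin n) :
    Tendsto (fun z : Rbar n × ℝ => translateBy (z.2 • v) z.1 i) (𝓝 (x, 0)) (𝓝 (x i)) := by
  have h0 : x i = x i + (((0 : ℝ) • v) i : ℝ) := by simp
  have h1 : Tendsto (fun z : Rbar n × ℝ => (z.1 i, (((z.2 • v) i : ℝ) : EReal))) (𝓝 (x, 0))
      (𝓝 (x i, (((0 : ℝ) • v) i : ℝ))) := by
    refine Continuous.tendsto (f := fun z : Rbar n × ℝ => (z.1 i, (((z.2 • v) i : ℝ) : EReal)))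
      ?_ (x, 0)
    refine Continuous.prodMk ((continuous_apply i).comp continuous_fst)
      (continuous_coe_real_ereal.comp ?_)
    exact continuous_snd.mul continuous_const
  conv => rhs; rw [h0]
  exact Tendsto.comp (EReal.continuousAt_add (.inr (EReal.coe_ne_bot _))
    (.inr (EReal.coe_ne_top _))) h1

theorem tendsto_fst_apply (x : Rbar n) (i : Fin n) :
    Tendsto (fun z : Rbar n × ℝ => z.1 i) (𝓝 (x, 0)) (𝓝 (x i)) :=
  ((continuous_apply i).comp continuous_fst).tendsto (x, (0 : ℝ))

theorem eventually_lt_iff_lt {α : Type*} {l : Filter α} {a b a' b' : α → EReal} {A B : EReal}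
    (ha : Tendsto a l (𝓝 A)) (hb : Tendsto b l (𝓝 B)) (ha' : Tendsto a' l (𝓝 A))
    (hb' : Tendsto b' l (𝓝 B)) (hne : A ≠ B) : ∀ᶠ z in l, a z < b z ↔ a' z < b' z := by
  rcases hne.lt_or_gt with h | h
  · filter_upwards [ha.eventually_lt hb h, ha'.eventually_lt hb' h] with z h1 h2
    exact iff_of_true h1 h2
  · filter_upwards [hb.eventually_lt ha h, hb'.eventually_lt ha' h] with z h1 h2
    exact iff_of_false h1.not_gt h2.not_gt

/-- A comparison that is strict at `x` persists nearby by continuity; one that is an equality at `x`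
involves a coordinate that `v` does not move. -/
theorem Tangent.eventually_samePos (hG : G.Finite) {x : Rbar n} {v : Fin n → ℝ}
    (h : Tangent G x v) :
    ∀ᶠ z in 𝓝 (x, (0 : ℝ)), SamePos G z.1 (translateBy (z.2 • v) z.1) := by
  refine eventually_all.2 fun i => (eventually_all_finite (finite_extValues hG)).2 fun c hc => ?_
  by_cases hv : v i = 0
  · exact .of_forall fun z => by simp [translateBy, hv]
  · have hne : x i ≠ c := fun hx => hv (h.1 i (hx ▸ hc))
    exact (eventually_lt_iff_lt (tendsto_fst_apply x i) tendsto_const_nhds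
      (tendsto_translateBy_apply x v i) tendsto_const_nhds hne).and
      (eventually_lt_iff_lt tendsto_const_nhds (tendsto_fst_apply x i) tendsto_const_nhds
      (tendsto_translateBy_apply x v i) hne.symm)

theorem Tangent.eventually_sameDiffPos (hG : G.Finite) {x : Rbar n} {v : Fin n → ℝ}
    (h : Tangent G x v) :
    ∀ᶠ z in 𝓝 (x, (0 : ℝ)), SameDiffPos G z.1 (translateBy (z.2 • v) z.1) := by
  refine eventually_all.2 fun i => eventually_all.2 fun j => (eventually_all_finite hG).2
    fun g hg => (eventually_all_finite hG).2 fun k hk => ?_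
  by_cases hx : x i + (k : EReal) = x j + (g : EReal)
  · have hv := h.2 i j g hg k hk hx
    refine .of_forall fun z => ?_
    simp only [translateBy, Pi.smul_apply, hv]
    rw [add_right_comm, add_right_comm (z.1 j), add_coe_lt_add_coe_iff]
  · exact eventually_lt_iff_lt
      (((continuous_add_coe k).tendsto _).comp (tendsto_fst_apply x i))
      (((continuous_add_coe g).tendsto _).comp (tendsto_fst_apply x j))
      (((continuous_add_coe k).tendsto _).comp (tendsto_translateBy_apply x v i))
      (((continuous_add_coe g).tendsto _).comp (tendsto_translateBy_apply x v j)) hx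

theorem IsGridSet.locallyInvariant (hG : G.Finite) {Q : Set (Rbar n)} (hQ : IsGridSet G Q)
    {x : Rbar n} {v : Fin n → ℝ} (h : Tangent G x v) : LocallyInvariant Q x v := by
  filter_upwards [h.eventually_samePos hG] with z hz
  exact ⟨hQ _ _ hz, hQ _ _ hz.symm⟩

theorem IsGridSet.locallyInvariant_sweep (hG : G.Finite) {f : Set (Rbar n)}
    (hf : IsGridSet G f) {x : Rbar n} {v : Fin n → ℝ} (h : Tangent G x v) :
    LocallyInvariant (sweep f) x v := by
  filter_upwards [h.eventually_samePos hG, h.eventually_sameDiffPos hG] with z hz hz'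
  exact ⟨hf.mem_sweep hG hz hz', hf.mem_sweep hG hz.symm hz'.symm⟩

theorem LocallyInvariant.inter {Q Q' : Set (Rbar n)} {x : Rbar n} {v : Fin n → ℝ}
    (h : LocallyInvariant Q x v) (h' : LocallyInvariant Q' x v) :
    LocallyInvariant (Q ∩ Q') x v := by
  filter_upwards [h, h'] with z hz hz'
  exact and_congr hz hz'

theorem continuous_translateBy (v : Fin n → ℝ) :
    Continuous (translateBy v : Rbar n → Rbar n) :=
  continuous_pi fun i => (continuous_add_coe (v i)).comp (continuous_apply i)

theorem LocallyInvariant.closure {Q : Set (Rbar n)} {x : Rbar n} {v : Fin n → ℝ}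
    (h : LocallyInvariant Q x v) : LocallyInvariant (closure Q) x v := by
  have h' : ∀ᶠ z in 𝓝 (x, (0 : ℝ)), z.1 ∈ Q → translateBy (z.2 • v) z.1 ∈ Q :=
    h.mono fun _ hz => hz.1
  have h1 : ∀ᶠ z in 𝓝 (x, (0 : ℝ)),
      z.1 ∈ _root_.closure Q → translateBy (z.2 • v) z.1 ∈ _root_.closure Q := by
    filter_upwards [h'.eventually_nhds] with z hz hzQ
    have hz' : ∀ᶠ p in 𝓝 z.1, p ∈ Q → translateBy (z.2 • v) p ∈ Q :=
      ((Continuous.prodMk_left z.2).tendsto z.1).eventually hz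
    rw [mem_closure_iff_frequently] at hzQ ⊢
    exact ((continuous_translateBy (z.2 • v)).tendsto z.1).frequently
      ((hzQ.and_eventually hz').mono fun p hp => hp.2 hp.1)
  -- The converse implication is the forward one applied at the translated point with parameter
  -- `-s`, which is again close to `(x, 0)`.
  have h2 : Tendsto (fun z : Rbar n × ℝ => (translateBy (z.2 • v) z.1, -z.2)) (𝓝 (x, 0))
      (𝓝 (x, 0)) := by
    refine Tendsto.prodMk_nhds (tendsto_pi_nhds.2 fun i => tendsto_translateBy_apply x v i) ?_
    exact Continuous.tendsto' (continuous_snd.neg) _ _ (by simp)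
  filter_upwards [h1, h2.eventually h1] with z hz hz'
  refine ⟨hz, fun hq => ?_⟩
  convert hz' hq using 1
  funext i
  simp only [translateBy, Pi.smul_apply, smul_eq_mul]
  rw [add_assoc, ← EReal.coe_add]
  simp

/-- The values that are reached from the grid values by `m` differences of `G`. -/
def gridLevel (G : Set ℝ) : ℕ → Set EReal
  | 0 => extValues G
  | m + 1 => gridLevel G m ∪
      ⋃ g ∈ G, ⋃ h ∈ G, (fun z : EReal => z + ((g - h : ℝ) : EReal)) '' gridLevel G m

theorem finite_gridLevel (hG : G.Finite) (m : ℕ) : (gridLevel G m).Finite := by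
  induction m with
  | zero => exact finite_extValues hG
  | succ m ih => exact ih.union (hG.biUnion fun g _ => hG.biUnion fun h _ => ih.image _)

theorem mem_gridLevel_succ {x y : EReal} {g h : ℝ} {m : ℕ} (hy : y ∈ gridLevel G m)
    (hg : g ∈ G) (hh : h ∈ G) (hxy : x + (h : EReal) = y + (g : EReal)) :
    x ∈ gridLevel G (m + 1) := by
  refine .inr ?_
  simp only [mem_iUnion]
  refine ⟨g, hg, h, hh, y, hy, ?_⟩
  have h1 : (y + (g : EReal)) + ((-h : ℝ) : EReal) = x := by
    rw [← hxy, add_assoc, ← EReal.coe_add, add_neg_cancel, EReal.coe_zero, add_zero]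
  rw [← h1, add_assoc, ← EReal.coe_add, sub_eq_add_neg]

/-- Link coordinates that differ by a difference of `G`. If some coordinates were not linked through
a chain to a grid value, moving all of them simultaneously would be a nonzero tangent direction. The
sets `W m` of coordinates reached in `m` steps grow strictly until they are everything, so `n + 1`
steps suffice. -/
theorem mem_gridLevel_of_tangent {x : Rbar n} (hx : ∀ v, Tangent G x v → v = 0) (i : Fin n) :
    x i ∈ gridLevel G (n + 1) := by
  let W : ℕ → Set (Fin n) := fun m => {i | x i ∈ gridLevel G m}
  have hmono : ∀ m, W m ⊆ W (m + 1) := fun m i hi => .inl hi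
  have hstep : ∀ m, W m = W (m + 1) → W m = univ := by
    intro m hm
    classical
    have h0 : extValues G ⊆ gridLevel G m := by
      clear hm
      induction m with
      | zero => exact subset_rfl
      | succ m ih => exact ih.trans subset_union_left
    -- Once `W m` is stable, the indicator of its complement is constant along links and zero at
    -- grid values, hence tangent.
    have hv := hx (fun i => if i ∈ W m then 0 else 1) ⟨fun i hi => if_pos (h0 hi), ?_⟩
    · refine eq_univ_of_forall fun i => ?_
      by_contra hi
      have := congrFun hv i
      simp [hi] at this
    · intro i j g hg h hh hij
      have : i ∈ W m ↔ j ∈ W m := by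
        constructor <;> intro hi <;> rw [hm]
        · exact mem_gridLevel_succ hi hh hg hij.symm
        · exact mem_gridLevel_succ hi hg hh hij
      simp [this]
  have hcard : ∀ m, W m = univ ∨ m ≤ (W m).ncard := by
    intro m
    induction m with
    | zero => simp
    | succ m ih =>
      by_cases h : W m = W (m + 1)
      · exact .inl (h ▸ hstep m h)
      · rcases ih with ih | ih
        · exact .inl (univ_subset_iff.1 (ih ▸ hmono m))
        · exact .inr (ih.trans_lt (ncard_lt_ncard ((hmono m).ssubset_of_ne h)))
  have huniv : W (n + 1) = univ := by
    refine (hcard (n + 1)).resolve_right fun h => ?_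
    have := (W (n + 1)).ncard_le_card
    simp at this
    omega
  have : i ∈ W (n + 1) := huniv ▸ mem_univ i
  exact this

theorem vertices_subset_of_tangent {Q : Set (Rbar n)}
    (h : ∀ x v, Tangent G x v → LocallyInvariant Q x v) :
    vertices Q ⊆ {x | ∀ i, x i ∈ gridLevel G (n + 1)} := by
  intro x hx
  refine mem_gridLevel_of_tangent fun v hv => ?_
  by_contra hv0
  refine hx.2 v (fun i hi => hv.1 i ?_) hv0 (h x v hv).closure
  exact hi.imp id .inl

/-! ### Finiteness of both vertex sets. -/

theorem finite_setOf_gridLevel (n : ℕ) (hG : G.Finite) :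
    {x : Rbar n | ∀ i, x i ∈ gridLevel G (n + 1)}.Finite :=
  Set.Finite.pi' fun _ => finite_gridLevel hG _

theorem RectDecomp.finite_vertices (h : RectDecomp I T) : (vertices I).Finite := by
  obtain ⟨G, hGfin, hG⟩ := exists_gridCoords h.finite
  exact (finite_setOf_gridLevel n hGfin).subset
    (vertices_subset_of_tangent fun _ _ hv => (h.isGridSet hG).locallyInvariant hGfin hv)

theorem RectDecomp.finite_Vbar {J : Set (Rbar n)} {S : Set (Rbar n × Rbar n)}
    (hI : RectDecomp I T) (hJ : RectDecomp J S) : (Vbar I J).Finite := by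
  obtain ⟨G₁, hG₁fin, hG₁⟩ := exists_gridCoords hI.finite
  obtain ⟨G₂, hG₂fin, hG₂⟩ := exists_gridCoords hJ.finite
  have hfin := hG₁fin.union hG₂fin
  have hgrid : ∀ f ∈ facets I ∪ facets J, IsGridSet (G₁ ∪ G₂) f := by
    rintro f (hf | hf)
    · exact hI.isGridSet_of_isFacet hfin (hG₁.mono subset_union_left) hf
    · exact hJ.isGridSet_of_isFacet hfin (hG₂.mono subset_union_right) hf
  refine (finite_setOf_gridLevel n hfin).subset ?_
  rintro x ⟨f, hf, g, hg, hx⟩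
  exact vertices_subset_of_tangent (fun _ _ hv =>
    ((hgrid f hf).locallyInvariant_sweep hfin hv).inter
      ((hgrid g hg).locallyInvariant hfin hv)) hx

end Grid

/-! ## The distance is attained at a corner, and is a candidate value -/

section Candidates

variable {n : ℕ} {I J : PosetInterval n} {S T : Set (Rbar n × Rbar n)} {δ : ℝ}

theorem candidateS_comm (I J : Set (Rbar n)) : candidateS I J = candidateS J I := by
  have hD : ∀ x, D I J x = D J I x := fun x => by
    ext d
    simp only [D, mem_ofPred_eq]
    tauto
  simp only [candidateS, union_comm (vertices I), hD]

theorem candidateShat_comm (I J : Set (Rbar n)) : candidateShat I J = candidateShat J I := by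
  have hD : ∀ x, Dhat I J x = Dhat J I x := fun x => by
    ext d
    simp only [Dhat, mem_ofPred_eq, or_comm]
  simp only [candidateShat, union_comm (vertices I), hD]

theorem IsEntry.mem_Dhat {A B : PosetInterval n} {x : Rbar n} {τ : ℝ}
    (h : IsEntry A.carrier (shift τ x)) (hT : RectDecomp A.carrier T) :
    ENNReal.ofReal |τ| ∈ Dhat A.carrier B.carrier x ∩ Dhat B.carrier A.carrier x := by
  obtain ⟨i, ⟨c, hc⟩, r, hr, hri⟩ := h.exists_minimal hT
  have hf := hri ▸ hT.isFacet_of_minimal hr i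
  exact ⟨⟨i, _, _, .inl hf, (dl_flat hc).symm⟩, ⟨i, _, _, .inr hf, (dl_flat hc).symm⟩⟩

theorem IsExit.mem_Dhat {A B : PosetInterval n} {x : Rbar n} {τ : ℝ}
    (h : IsExit A.carrier (shift τ x)) (hT : RectDecomp A.carrier T) :
    ENNReal.ofReal |τ| ∈ Dhat A.carrier B.carrier x ∩ Dhat B.carrier A.carrier x := by
  obtain ⟨i, ⟨c, hc⟩, r, hr, hri⟩ := h.exists_maximal hT
  have hf := hri ▸ hT.isFacet_of_maximal hr i
  exact ⟨⟨i, _, _, .inl hf, (dl_flat hc).symm⟩, ⟨i, _, _, .inr hf, (dl_flat hc).symm⟩⟩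

/-- Either the reaching condition at `δ` persists for slightly smaller values, or one of two
subsets of the line has an endpoint at `2δ` or at `δ`. -/
theorem eventually_reach_or {A B : Set ℝ} (hA : IsClosed A) (hB : IsClosed B)
    (hB0 : (0 : ℝ) ∈ B) (hBc : B.OrdConnected) (hδ : 0 ≤ δ)
    (h : ∀ d, δ < d → 2 * d ∈ B → ∃ t ≤ d, t ∈ A) :
    (∀ᶠ d in 𝓝[<] δ, 2 * d ∈ B → ∃ t ≤ d, t ∈ A) ∨
      (2 * δ ∈ B ∧ ∀ ε > 0, 2 * δ + ε ∉ B) ∨ (δ ∈ A ∧ ∀ t < δ, t ∉ A) := by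
  by_cases h1 : ∃ t < δ, t ∈ A
  · obtain ⟨t, ht, htA⟩ := h1
    left
    filter_upwards [Ioo_mem_nhdsLT ht] with d hd _ using ⟨t, hd.1.le, htA⟩
  push Not at h1
  by_cases h2 : 2 * δ ∈ B
  · by_cases h3 : ∀ ε > 0, 2 * δ + ε ∉ B
    · exact .inr (.inl ⟨h2, h3⟩)
    · push Not at h3
      obtain ⟨ε, hε, hεB⟩ := h3
      -- Here `B` continues beyond `2δ`, so the hypothesis applies at `δ + m` for all small `m`. It
      -- gives points of `A` in `[δ, δ + m]`, and `A` is closed.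
      refine .inr (.inr ⟨hA.closure_subset (Metric.mem_closure_iff.2 fun η hη => ?_), h1⟩)
      obtain ⟨m, hm, hm'⟩ : ∃ m > 0, m < η ∧ 2 * m ≤ ε :=
        ⟨min (η / 2) (ε / 2), by positivity,
          by have := min_le_left (η / 2) (ε / 2); linarith,
          by have := min_le_right (η / 2) (ε / 2); linarith⟩
      obtain ⟨t, ht, htA⟩ := h (δ + m) (by linarith)
        (hBc.out hB0 hεB ⟨by linarith, by linarith⟩)
      have : δ ≤ t := not_lt.1 fun hlt => h1 t hlt htA
      exact ⟨t, htA, by rw [dist_comm, Real.dist_eq, abs_of_nonneg] <;> linarith⟩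
  · left
    have : ∀ᶠ d in 𝓝 δ, 2 * d ∈ Bᶜ :=
      ((continuous_const.mul continuous_id).tendsto δ).eventually (hB.isOpen_compl.mem_nhds h2)
    filter_upwards [this.filter_mono nhdsWithin_le_nhds] with d hd hd' using absurd hd' hd

theorem PosetInterval.ordConnected_shift (J : PosetInterval n) (r : Rbar n) :
    {t : ℝ | shift t r ∈ J.carrier}.OrdConnected :=
  ⟨fun _ hs _ ht _ hu => J.convex _ hs _ ht _ (shift_le_shift hu.1 r) (shift_le_shift hu.2 r)⟩

/-- If no value attained at a corner of `J` is equal to `δ`, then the corner condition holds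
slightly below `δ`. -/
theorem eventually_cornersReach (hS : RectDecomp I.carrier S)
    (hT : RectDecomp J.carrier T) (hδ : 0 ≤ δ)
    (h : ∀ r ∈ corners J.carrier, ∀ d, δ < d → ∃ e, 0 ≤ e ∧ e < d ∧ ∀ p ∈ diag r,
      p ∈ J.carrier → shift (2 * e) p ∈ J.carrier → shift e p ∈ I.carrier) :
    (∀ᶠ d in 𝓝[<] δ, CornersReach I.carrier J.carrier d) ∨
      (ENNReal.ofReal δ ∈ candidateS I.carrier J.carrier ∧
        ENNReal.ofReal δ ∈ candidateShat I.carrier J.carrier) := by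
  by_cases hcand : ENNReal.ofReal δ ∈ candidateS I.carrier J.carrier ∧
        ENNReal.ofReal δ ∈ candidateShat I.carrier J.carrier
  · exact .inr hcand
  refine .inl ?_
  have h2δ : 0 ≤ 2 * δ := by positivity
  have hclI : ∀ r, IsClosed {t : ℝ | shift t r ∈ I.carrier} := fun r =>
    hS.isClosed.preimage (continuous_shift_left r)
  have hclJ : ∀ r, IsClosed {t : ℝ | shift t r ∈ J.carrier} := fun r =>
    hT.isClosed.preimage (continuous_shift_left r)
  have hδ1 : ENNReal.ofReal |δ| = ENNReal.ofReal δ := by rw [abs_of_nonneg hδ]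
  have hδ2 : ENNReal.ofReal |2 * δ| = 2 * ENNReal.ofReal δ := by
    rw [abs_of_nonneg h2δ, ENNReal.ofReal_mul zero_le_two, ENNReal.ofReal_ofNat]
  have hv : ∀ r ∈ corners J.carrier, r ∈ vertices I.carrier ∪ vertices J.carrier :=
    fun r hr => .inr (hT.corners_subset_vertices hr)
  have hmin : ∀ r, Minimal (· ∈ J.carrier) r → ∀ᶠ d in 𝓝[<] δ,
      shift (2 * d) r ∈ J.carrier → ∃ t ≤ d, shift t r ∈ I.carrier := by
    intro r hr
    rcases eventually_reach_or (δ := δ) (hclI r) (hclJ r) (by simpa [shift_zero] using hr.prop)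
      (J.ordConnected_shift r) hδ (fun d hd h2d => by
        obtain ⟨e, he0, hed, he⟩ := h r (.inl hr) d hd
        refine ⟨e, hed.le, he r (self_mem_diag r) hr.prop ?_⟩
        exact J.convex _ hr.prop _ h2d _ (le_shift _ (by positivity) r)
          (shift_le_shift (by linarith) r)) with h1 | h1 | h1
    · exact h1
    -- The length condition at `r` stops at `2δ`: twice `δ` is the distance from `r` to the upper
    -- boundary of its own interval.
    · have hex : IsExit J.carrier (shift (2 * δ) r) := ⟨h1.1, fun ε hε => by
        rw [shift_shift, add_comm]
        exact h1.2 ε hε⟩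
      refine absurd ⟨⟨r, hv r (.inl hr), .inr (.inr (.inr (.inr ?_)))⟩,
        ⟨r, hv r (.inl hr), .inr ?_⟩⟩ hcand
      · rw [hex.dl_upperBd_of_minimal h2δ hT hr, hδ2]
      · exact hδ2 ▸ (hex.mem_Dhat hT).2
    -- The diagonal of `r` first meets `I` at `δ`, which is then the distance from `r` to the lower
    -- boundary of `I`.
    · have hex : IsEntry I.carrier (shift δ r) := ⟨h1.1, fun ε hε => by
        rw [shift_shift]
        exact h1.2 _ (by linarith)⟩
      refine absurd ⟨⟨r, hv r (.inl hr), .inl (.inl ?_)⟩, ⟨r, hv r (.inl hr), .inl ?_⟩⟩ hcand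
      · rw [hex.dl_lowerBd hδ hS, hδ1]
      · exact hδ1 ▸ (hex.mem_Dhat hS).1
  have hmax : ∀ r, Maximal (· ∈ J.carrier) r → ∀ᶠ d in 𝓝[<] δ,
      shift (-(2 * d)) r ∈ J.carrier → ∃ t ≤ d, shift (-t) r ∈ I.carrier := by
    intro r hr
    rcases eventually_reach_or (δ := δ) ((hclI r).preimage continuous_neg)
      ((hclJ r).preimage continuous_neg) (by simpa [shift_zero] using hr.prop)
      ⟨fun a ha b hb c hc => (J.ordConnected_shift r).out hb ha
        ⟨neg_le_neg hc.2, neg_le_neg hc.1⟩⟩ hδ (fun d hd h2d => by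
        obtain ⟨e, he0, hed, he⟩ := h r (.inr hr) d hd
        -- For a maximal `r` the segment of length `2e` ends at `r`, so its midpoint is `r - e`.
        have h3 := he (shift (-(2 * e)) r) ⟨_, rfl⟩
          (J.convex _ h2d _ hr.prop _ (shift_le_shift (by linarith) r)
            (shift_le_comm.2 (by simpa using le_shift _ (by positivity) r)))
          (by rw [shift_shift, add_neg_cancel, shift_zero]; exact hr.prop)
        rw [shift_shift] at h3
        refine ⟨e, hed.le, ?_⟩
        change shift (-e) r ∈ I.carrier
        convert h3 using 2
        ring) with h1 | h1 | h1
    · exact h1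
    · have hex : IsEntry J.carrier (shift (-(2 * δ)) r) := ⟨h1.1, fun ε hε => by
        rw [shift_shift, ← neg_add, add_comm]
        exact h1.2 ε hε⟩
      refine absurd ⟨⟨r, hv r (.inr hr), .inr (.inr (.inl ?_))⟩,
        ⟨r, hv r (.inr hr), .inr ?_⟩⟩ hcand
      · rw [hex.dl_lowerBd_of_maximal h2δ hT hr, hδ2]
      · exact hδ2 ▸ abs_neg (2 * δ) ▸ (hex.mem_Dhat hT).2
    · have hex : IsExit I.carrier (shift (-δ) r) := ⟨h1.1, fun ε hε => by
        rw [shift_shift]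
        have := h1.2 (δ - ε) (by linarith)
        rwa [mem_preimage, neg_sub, sub_eq_add_neg] at this⟩
      refine absurd ⟨⟨r, hv r (.inr hr), .inl (.inr (.inr (.inl ?_)))⟩,
        ⟨r, hv r (.inr hr), .inl ?_⟩⟩ hcand
      · rw [hex.dl_upperBd hδ hS, hδ1]
      · exact hδ1 ▸ abs_neg δ ▸ (hex.mem_Dhat hS).1
  have hfin := hT.finite_corners
  have h1 := (eventually_all_finite (hfin.subset fun r hr => .inl hr :
    {r | Minimal (· ∈ J.carrier) r}.Finite)).2 hmin
  have h2 := (eventually_all_finite (hfin.subset fun r hr => .inr hr :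
    {r | Maximal (· ∈ J.carrier) r}.Finite)).2 hmax
  filter_upwards [h1, h2] with d hd1 hd2 using ⟨hd1, hd2⟩

theorem CornersReach.eventually_atTop (hT : RectDecomp J.carrier T)
    (h1 : ∀ r, Minimal (· ∈ J.carrier) r → ∀ᶠ d : ℝ in atTop,
      shift (2 * d) r ∈ J.carrier → ∃ t ≤ d, shift t r ∈ I.carrier)
    (h2 : ∀ r, Maximal (· ∈ J.carrier) r → ∀ᶠ d : ℝ in atTop,
      shift (-(2 * d)) r ∈ J.carrier → ∃ t ≤ d, shift (-t) r ∈ I.carrier) :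
    ∀ᶠ d : ℝ in atTop, CornersReach I.carrier J.carrier d := by
  have hfin := hT.finite_corners
  filter_upwards [(eventually_all_finite (hfin.subset fun r hr => .inl hr :
    {r | Minimal (· ∈ J.carrier) r}.Finite)).2 h1, (eventually_all_finite
    (hfin.subset fun r hr => .inr hr : {r | Maximal (· ∈ J.carrier) r}.Finite)).2 h2]
    with d hd1 hd2 using ⟨hd1, hd2⟩

/-- The diagonal of each corner of `J` has finite distance to the lower boundary of `I`, so it meets
`I`, and any `d` at least as large as the required shift is enough. -/
theorem eventually_cornersReach_of_top_notMem_candidateS (hT : RectDecomp J.carrier T)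
    (hS : RectDecomp I.carrier S) (h : ⊤ ∉ candidateS I.carrier J.carrier) :
    ∀ᶠ d : ℝ in atTop, CornersReach I.carrier J.carrier d := by
  have hex : ∀ r ∈ corners J.carrier, ∃ t, shift t r ∈ I.carrier := by
    intro r hr
    have h1 : dl r (lowerBd I.carrier) ≠ ⊤ := fun h1 =>
      h ⟨r, .inr (hT.corners_subset_vertices hr), .inl (.inl h1.symm)⟩
    obtain ⟨t, ht⟩ := exists_shift_mem_of_dl_ne_top h1
    exact ⟨t, hS.isClosed.closure_eq ▸ ht.1⟩
  refine CornersReach.eventually_atTop hT (fun r hr => ?_) fun r hr => ?_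
  · obtain ⟨t, ht⟩ := hex r (.inl hr)
    filter_upwards [eventually_ge_atTop t] with d hd _ using ⟨t, hd, ht⟩
  · obtain ⟨t, ht⟩ := hex r (.inr hr)
    filter_upwards [eventually_ge_atTop (-t)] with d hd _
    exact ⟨-t, hd, by rwa [neg_neg]⟩

/-- Finite distances between corners and facet flats force the `i`-th coordinate of every corner to
be finite. Then `J` is bounded in that coordinate, no diagonal through a corner stays in `J` for
long, and the condition is vacuous for large `d`. -/
theorem eventually_cornersReach_of_top_notMem_candidateShat (hn : 1 ≤ n)
    (hT : RectDecomp J.carrier T) (h : ⊤ ∉ candidateShat I.carrier J.carrier) :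
    ∀ᶠ d : ℝ in atTop, CornersReach I.carrier J.carrier d := by
  let i : Fin n := ⟨0, hn⟩
  have hex : ∀ r ∈ corners J.carrier, ∀ s ∈ corners J.carrier, ∃ t, shift t r ∈ flat i (s i) := by
    intro r hr s hs
    obtain ⟨f, hf, -⟩ := hT.exists_isFacet hn hs i
    exact exists_shift_mem_of_dl_ne_top fun h1 =>
      h ⟨r, .inr (hT.corners_subset_vertices hr), .inl ⟨i, _, f, .inr hf, h1.symm⟩⟩
  obtain ⟨p, hp⟩ := J.nonempty
  obtain ⟨r₀, hr₀, -⟩ := hT.exists_minimal_le hp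
  obtain ⟨s₀, hs₀, -⟩ := hT.exists_maximal_ge hp
  have hfin : ∀ r ∈ corners J.carrier, ∃ c : ℝ, r i = c := by
    intro r hr
    rcases eq_top_or_bot_or_coe (r i) with hi | hi | hi
    -- A coordinate `⊤` is fixed by shifts, so it could not reach the flat through the minimal point
    -- `r₀`, whose coordinates are not `⊤`. The maximal point `s₀` excludes `⊥` in the same way.
    · obtain ⟨t, ht⟩ := hex r hr r₀ (.inl hr₀)
      have ht' : r i + (t : EReal) = r₀ i := ht
      rw [hi, EReal.top_add_coe] at ht'
      exact absurd ht'.symm (hT.ne_top hr₀ i)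
    · obtain ⟨t, ht⟩ := hex r hr s₀ (.inr hs₀)
      have ht' : r i + (t : EReal) = s₀ i := ht
      rw [hi, EReal.bot_add] at ht'
      exact absurd ht'.symm (hT.ne_bot hs₀ i)
    · exact hi
  refine CornersReach.eventually_atTop hT (fun r hr => ?_) fun r hr => ?_
  · have h1 : ∀ s ∈ corners J.carrier, ∀ᶠ d : ℝ in atTop, s i < shift (2 * d) r i := by
      intro s hs
      obtain ⟨a, ha⟩ := hfin r (.inl hr)
      obtain ⟨b, hb⟩ := hfin s hs
      filter_upwards [eventually_gt_atTop ((b - a) / 2)] with d hd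
      rw [shift_apply, ha, hb, ← EReal.coe_add, EReal.coe_lt_coe_iff]
      linarith
    filter_upwards [(eventually_all_finite hT.finite_corners).2 h1] with d hd hdJ
    obtain ⟨s, hs, hds⟩ := hT.exists_maximal_ge hdJ
    exact absurd (hds i) (hd s (.inr hs)).not_ge
  · have h1 : ∀ s ∈ corners J.carrier, ∀ᶠ d : ℝ in atTop, shift (-(2 * d)) r i < s i := by
      intro s hs
      obtain ⟨a, ha⟩ := hfin r (.inr hr)
      obtain ⟨b, hb⟩ := hfin s hs
      filter_upwards [eventually_gt_atTop ((a - b) / 2)] with d hd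
      rw [shift_apply, ha, hb, ← EReal.coe_add, EReal.coe_lt_coe_iff]
      linarith
    filter_upwards [(eventually_all_finite hT.finite_corners).2 h1] with d hd hdJ
    obtain ⟨s, hs, hds⟩ := hT.exists_minimal_le hdJ
    exact absurd (hds i) (hd s (.inl hs)).not_ge

/-! ### The value of `δ*` from slice distances at corners. -/

variable {K : Type u} [Field K]

theorem cornersReach_of_interleavingDist_lt
    (h : ∀ r ∈ corners J.carrier, interleavingDist (slice (intervalModule K J) r)
      (slice (intervalModule K I) r) < ENNReal.ofReal δ) :
    CornersReach I.carrier J.carrier δ := by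
  constructor
  · intro r hr hr'
    obtain ⟨e, he0, hed, he⟩ := exists_shift_mem_of_interleavingDist_lt (h r (.inl hr))
    exact ⟨e, hed.le, he r (self_mem_diag r) hr.prop (J.convex _ hr.prop _ hr' _
      (le_shift _ (by positivity) r) (shift_le_shift (by linarith) r))⟩
  · intro r hr hr'
    obtain ⟨e, he0, hed, he⟩ := exists_shift_mem_of_interleavingDist_lt (h r (.inr hr))
    have h3 := he (shift (-(2 * e)) r) ⟨_, rfl⟩
      (J.convex _ hr' _ hr.prop _ (shift_le_shift (by linarith) r)
        (shift_le_comm.2 (by simpa using le_shift _ (by positivity) r)))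
      (by rw [shift_shift, add_neg_cancel, shift_zero]; exact hr.prop)
    refine ⟨e, hed.le, ?_⟩
    rw [shift_shift] at h3
    convert h3 using 2
    ring

/-- `δ*` is the maximum of the slice distances over the corners of the two intervals. -/
theorem exists_corner_deltaStar_le (hS : RectDecomp I.carrier S) (hT : RectDecomp J.carrier T) :
    ∃ r ∈ corners I.carrier ∪ corners J.carrier,
      deltaStar (intervalModule K I) (intervalModule K J) ≤
        interleavingDist (slice (intervalModule K I) r) (slice (intervalModule K J) r) := by
  obtain ⟨p, hp⟩ := I.nonempty
  obtain ⟨r₀, hr₀, -⟩ := hS.exists_minimal_le hp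
  obtain ⟨r, hr, hmax⟩ := (hS.finite_corners.union hT.finite_corners).exists_maximalFor
    (fun r => interleavingDist (slice (intervalModule K I) r) (slice (intervalModule K J) r))
    _ ⟨r₀, .inl (.inl hr₀)⟩
  refine ⟨r, hr, ?_⟩
  by_contra! hlt
  -- A value strictly between the largest corner distance and `δ*` would satisfy both corner
  -- conditions, and hence bound `δ*` from above.
  obtain ⟨d, hrd, hd⟩ := ENNReal.lt_iff_exists_nnreal_btwn.1 hlt
  have key : ∀ s ∈ corners I.carrier ∪ corners J.carrier,
      interleavingDist (slice (intervalModule K I) s) (slice (intervalModule K J) s)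
        < ENNReal.ofReal d := by
    intro s hs
    rw [ENNReal.ofReal_coe_nnreal]
    refine lt_of_le_of_lt ?_ hrd
    rcases le_total (interleavingDist (slice (intervalModule K I) s)
      (slice (intervalModule K J) s)) (interleavingDist (slice (intervalModule K I) r)
      (slice (intervalModule K J) r)) with h | h
    · exact h
    · exact hmax hs h
  have h1 : CornersReach I.carrier J.carrier d := cornersReach_of_interleavingDist_lt (K := K)
    fun s hs => interleavingDist_comm (slice (intervalModule K I) s) _ ▸ key s (.inr hs)
  have h2 : CornersReach J.carrier I.carrier d := cornersReach_of_interleavingDist_lt (K := K)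
    fun s hs => key s (.inl hs)
  have h3 := h1.deltaStar_le (K := K) d.2 h2 hS hT
  rw [NNReal.val_eq_coe, ENNReal.ofReal_coe_nnreal] at h3
  exact hd.not_ge h3

theorem isGreatest_deltaStar (hS : RectDecomp I.carrier S) (hT : RectDecomp J.carrier T)
    {V : Set (Rbar n)} (hV : corners I.carrier ∪ corners J.carrier ⊆ V) :
    IsGreatest ((fun x => interleavingDist (slice (intervalModule K I) x)
        (slice (intervalModule K J) x)) '' V)
      (deltaStar (intervalModule K I) (intervalModule K J)) := by
  constructor
  · obtain ⟨r, hr, h⟩ := exists_corner_deltaStar_le (K := K) hS hT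
    exact ⟨r, hV hr, le_antisymm (interleavingDist_le_deltaStar _ _ r) h⟩
  · rintro _ ⟨x, -, rfl⟩
    exact interleavingDist_le_deltaStar _ _ x

theorem deltaStar_mem_candidates (hn : 1 ≤ n) (hS : RectDecomp I.carrier S)
    (hT : RectDecomp J.carrier T) :
    deltaStar (intervalModule K I) (intervalModule K J) ∈ candidateS I.carrier J.carrier ∧
      deltaStar (intervalModule K I) (intervalModule K J) ∈
        candidateShat I.carrier J.carrier := by
  have hfinite : (∀ᶠ d : ℝ in atTop, CornersReach I.carrier J.carrier d ∧
      CornersReach J.carrier I.carrier d) →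
      deltaStar (intervalModule K I) (intervalModule K J) ≠ ⊤ := by
    intro h
    obtain ⟨d, ⟨h1, h2⟩, hd⟩ := (h.and (eventually_ge_atTop 0)).exists
    exact ((h1.deltaStar_le (K := K) hd h2 hS hT).trans_lt ENNReal.ofReal_lt_top).ne
  by_cases htop : deltaStar (intervalModule K I) (intervalModule K J) = ⊤
  · rw [htop]
    constructor <;> by_contra hcon <;> refine hfinite ?_ htop
    · exact (eventually_cornersReach_of_top_notMem_candidateS hT hS hcon).and
        (eventually_cornersReach_of_top_notMem_candidateS hS hT (candidateS_comm _ _ ▸ hcon))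
    · exact (eventually_cornersReach_of_top_notMem_candidateShat hn hT hcon).and
        (eventually_cornersReach_of_top_notMem_candidateShat hn hS
          (candidateShat_comm _ _ ▸ hcon))
  obtain ⟨δ, hδ⟩ : ∃ δ : ℝ≥0, (δ : ℝ≥0∞) =
      deltaStar (intervalModule K I) (intervalModule K J) := ⟨_, ENNReal.coe_toNNReal htop⟩
  -- The value `0` has no room below it for a smaller interleaving; it is a candidate because a
  -- minimal point of `I` lies on its own boundary and flats.
  rcases eq_or_ne δ 0 with rfl | hδ0
  · obtain ⟨p, hp⟩ := I.nonempty
    obtain ⟨r, hr, -⟩ := hS.exists_minimal_le hp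
    have hv := hS.corners_subset_vertices (.inl hr)
    have hf := hS.isFacet_of_minimal hr ⟨0, hn⟩
    rw [← hδ, ENNReal.coe_zero]
    exact ⟨⟨r, .inl hv, .inl (.inl (dl_eq_zero (mem_lowerBd_of_minimal hn hr)).symm)⟩,
      ⟨r, .inl hv, .inl ⟨_, _, _, .inl hf, (dl_eq_zero (show r ∈ flat ⟨0, hn⟩ (r ⟨0, hn⟩) from rfl)).symm⟩⟩⟩
  have hpos : (0 : ℝ) < δ := by positivity
  have hdist : ∀ r, ∀ d : ℝ, (δ : ℝ) < d → interleavingDist (slice (intervalModule K I) r)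
      (slice (intervalModule K J) r) < ENNReal.ofReal d := by
    intro r d hd
    refine (interleavingDist_le_deltaStar _ _ r).trans_lt ?_
    rw [← hδ, ← ENNReal.ofReal_coe_nnreal]
    exact (ENNReal.ofReal_lt_ofReal_iff (hpos.trans hd)).2 hd
  rw [← hδ, ← ENNReal.ofReal_coe_nnreal]
  rcases eventually_cornersReach hS hT δ.2 (fun r _ d hd =>
    exists_shift_mem_of_interleavingDist_lt (K := K)
      (interleavingDist_comm (slice (intervalModule K I) r) _ ▸ hdist r d hd)) with h1 | h1
  · rcases eventually_cornersReach hT hS δ.2 (fun r _ d hd =>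
      exists_shift_mem_of_interleavingDist_lt (K := K) (hdist r d hd)) with h2 | h2
    -- Both corner conditions persist at some `d` with `0 < d < δ`, which would give `δ* ≤ d`.
    · obtain ⟨d, ⟨hd1, hd2⟩, hd0, hdδ⟩ := ((h1.and h2).and (Ioo_mem_nhdsLT hpos)).exists
      have h3 := hd1.deltaStar_le (K := K) hd0.le hd2 hS hT
      rw [← hδ, ← ENNReal.ofReal_coe_nnreal, ENNReal.ofReal_le_ofReal_iff hd0.le] at h3
      exact absurd hdδ h3.not_gt
    · rw [candidateS_comm, candidateShat_comm]
      exact h2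
  · exact h1

end Candidates

end MultiPers

open MultiPers
theorem mainTheorem5 {K : Type*} [Field K] (n : ℕ) (hn : 1 ≤ n) (I J : PosetInterval n)
    (hI : DiscretelyPresented I.carrier) (hJ : DiscretelyPresented J.carrier) :
    ((Vbar I.carrier J.carrier).Finite ∧
      IsGreatest
        ((fun x => interleavingDist (slice (intervalModule K I) x)
          (slice (intervalModule K J) x)) '' Vbar I.carrier J.carrier)
        (deltaStar (intervalModule K I) (intervalModule K J))) ∧
    (n = 2 →
      (vertices I.carrier ∪ vertices J.carrier).Finite ∧
      IsGreatest
        ((fun x => interleavingDist (slice (intervalModule K I) x)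
          (slice (intervalModule K J) x)) '' (vertices I.carrier ∪ vertices J.carrier))
        (deltaStar (intervalModule K I) (intervalModule K J))) ∧
    deltaStar (intervalModule K I) (intervalModule K J) ∈
      candidateS I.carrier J.carrier ∧
    deltaStar (intervalModule K I) (intervalModule K J) ∈
      candidateShat I.carrier J.carrier := by
  obtain ⟨S, hS⟩ := hI.exists_rectDecomp
  obtain ⟨T, hT⟩ := hJ.exists_rectDecomp
  refine ⟨⟨hS.finite_Vbar hT, isGreatest_deltaStar hS hT (Set.union_subset ?_ ?_)⟩,
    fun _ => ⟨hS.finite_vertices.union hT.finite_vertices,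
      isGreatest_deltaStar hS hT
        (Set.union_subset_union hS.corners_subset_vertices hT.corners_subset_vertices)⟩,
    deltaStar_mem_candidates hn hS hT⟩
  · exact fun r hr => (hS.corners_subset_Vbar hn _ hr).1
  · exact fun r hr => (hT.corners_subset_Vbar hn _ hr).2
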